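/- \textbf{Setting.} Let $n\in\mathbb N$, $1<p<\infty$, and let $d\ge 1$ be an integer with $dp\ge\log_2 9$. Let $\theta_0,\phi,\Phi\ge 2$ be integers with $\phi\le\Phi-\theta_0-\lceil\frac{2\theta_0}{2^{dp}-1}\rceil$, $\ \phi\le\theta_0\le\Phi$, $\ \Phi\ge\lceil 2^{dp}\rceil-1$, $\ \phi\le\lfloor 2^{dp}\rfloor-1-\theta_0-\lceil\frac{2\theta_0}{2^{dp}-1}\rceil$ and $\phi-\theta_0\le-\lceil\frac{4\theta_0}{2^{dp}-1}\rceil$. (Such integers exist, e.g. $\theta_0=4$, $\phi=2$, $\Phi=\lceil 2^{dp}\rceil-1$.) \textbf{Rectangles.} A parabolic rectangle is a set $R(\gamma)=Q(x,L)\times[t-L^p,t-\gamma L^p)\subset\mathbb R^{n+1}$, where $0\le\gamma\le\frac12$, $L>0$ and $Q(x,L)=\prod_i[x_i-\frac L2,x_i+\frac L2)$. Put $l_x(R(\gamma))=L$, $l_t(R(\gamma))=(1-\gamma)L^p$ and $R^\theta(\gamma)=R(\gamma)+(0,\theta\, l_t(R(\gamma)))$ for $\theta\in\mathbb R$. $|\cdot|$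 is Lebesgue measure. \textbf{Dyadic lattice.} $\mathcal D_1(R(\gamma))$ is the set of rectangles obtained by dividing each spatial edge of $R(\gamma)$ into $2^d$ equal half-open intervals and the temporal edge into $\lceil 2^{dp}\rceil$ equal half-open intervals if $\gamma\le 1-\frac{2^{dp}+1}{2^{dp+1}}$, and into $\lfloor 2^{dp}\rfloor$ otherwise; these are again parabolic rectangles. Put $\mathcal D_0(R)=\{R\}$, $\mathcal D_{i+1}(R)=\bigcup_{P\in\mathcal D_i(R)}\mathcal D_1(P)$, $\mathcal D(R)=\bigcup_{i\ge0}\mathcal D_i(R)$, $\mathcal D_i^{\mathrm{ext}}(R)=\bigcup_{j\in\mathbb Z}\mathcal D_i(R^j)$ and $\mathcal D^{\mathrm{ext}}(R)=\bigcup_{i\ge0}\mathcal D_i^{\mathrm{ext}}(R)$. For $P\in\mathcal D_m^{\mathrm{ext}}(R)$ with $m\ge1$ the parent $\pi P$ is the unique $Q\in\mathcal D^{\mathrm{ext}}(R)$ with $P\in\mathcal D_1(Q)$, and $\pi^+P=(\pi P)^{\theta_0}$; $\pi_i^+$ is the $i$-th iterate of $\pi^+$ (defined for $0\le i\le m$),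 and $\pi_i^+P^\theta:=(\pi_i^+P)^\theta$. \textbf{Weak porosity.} Let $E\subseteq\mathbb R^{n+1}$ be nonempty and closed. A set disjoint from $E$ is called $E$-free. $\mathcal F(R)$ is the collection of the maximal $E$-free rectangles of $\mathcal D(R)$ containing $z$, over all $z\in R\setminus E$. $\mathcal M(R)$ is a member of $\mathcal F(R)$ of largest side length $l_x$ (and $\emptyset$ if $\mathcal F(R)=\emptyset$). For $c,\delta\in(0,1)$ and $\theta\in\mathbb R$, $E$ is $(c,\delta,\theta)$-weakly porous if for every parabolic rectangle $R$ there are finitely many pairwise disjoint $E$-free $P_1,\dots,P_N\in\mathcal D(R)$ with $|P_k|\ge\delta|\mathcal M(R^\theta)|$ for all $k$ and $\sum_{k=1}^N|P_k|\ge c|R|$. \textbf{Stopping collections.} Put $\mathcal F_\delta^\theta(R)=\{P\in\mathcal F(R):|P|\ge\delta|\mathcal M(R^\theta)|\}$, let $F_\delta^\theta$ be the union of its members, and put $\mathcal G_\delta^\theta(R)=\{P\in\mathcal D(R)\setminus\{R\}:P\cap F_\delta^\theta=\emptyset,\ \pi P\cap F_\delta^\theta\ne\emptyset\}$. For $\Lambda>0$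 and $P\in\mathcal D_m^{\mathrm{ext}}(R)$ with $m\ge1$ let $$\tau_\Lambda(P)=\min\Big\{k\in\{1,\dots,m\}:\max_{\theta\in[\phi-\theta_0,\Phi-\theta_0]}|\mathcal M(\pi_k^+P^\theta)|\ge\Lambda\Big\},$$ undefined if there is no such $k$. For $\mathcal A\subseteq\mathcal D(R)$ and $k\ge1$ let $$\mathcal S_k(\mathcal A,\Lambda)=\bigcup_{P\in\mathcal A}\{\pi_i^+P:\ \tau_\Lambda(\pi_i^+P)=k,\ i=0,\dots,\tau_\Lambda(P)-1\},$$ where rectangles with undefined $\tau_\Lambda$ do not contribute. \textbf{Lemma.} There is $\lambda=\lambda(n,p,d)\in(0,1)$ such that the following holds. Let $E$ be $(c,\delta,\Phi)$-weakly porous for some $c,\delta\in(0,1)$, let $R$ be a parabolic rectangle (with any truncation parameter in $[0,\frac12]$), and let $\mathcal S_k=\mathcal S_k(\mathcal G_\delta^\Phi(R),\Lambda)$ with $\Lambda=\delta|\mathcal M(R^\Phi)|$. Then for every $k=1,2,\dots$: (i) if $\mathcal C\subseteq\mathcal S_k$ is nonempty and $\mathcal C\subseteq\mathcal D_1(\pi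 P)$ for every $P\in\mathcal C$, then $\mathcal C$ is a proper subset of $\mathcal D_1(\pi P)$ for every $P\in\mathcal C$; (ii) $\pi^+\mathcal S_{k+1}=\{\pi^+P:P\in\mathcal S_{k+1}\}$ consists of pairwise disjoint rectangles; (iii) $\displaystyle\Big|\bigcup_{Q\in\mathcal S_{k+1}}Q\Big|\le\lambda^k\Big|\bigcup_{P\in\mathcal S_1}P\Big|$. -/

import Mathlib

open MeasureTheory

noncomputable section

/-- Data of a (truncated) parabolic rectangle in `ℝⁿ × ℝ`: the lower spatial corner, the bottom
time, the spatial side length `L` and the truncation parameter `γ`.  In terms of the spatial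
centre `x` and the untruncated top time `t`, `corner i = x i - L / 2` and `bottom = t - L ^ p`. -/
@[ext]
structure PRect (n : ℕ) where
  corner : Fin n → ℝ
  bottom : ℝ
  side : ℝ
  trunc : ℝ

namespace PRect

variable {n : ℕ}

/-- The data describe an actual rectangle: `L > 0` and `0 ≤ γ ≤ 1/2`. -/
def Valid (R : PRect n) : Prop :=
  0 < R.side ∧ 0 ≤ R.trunc ∧ R.trunc ≤ 1 / 2

/-- Temporal side length `l_t(R(γ)) = (1 - γ) L ^ p`. -/
def lt (p : ℝ) (R : PRect n) : ℝ :=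
  (1 - R.trunc) * R.side ^ p

/-- The point set `Q(x, L) × [t - L ^ p, t - γ L ^ p)`. -/
def toSet (p : ℝ) (R : PRect n) : Set ((Fin n → ℝ) × ℝ) :=
  {z | (∀ i, R.corner i ≤ z.1 i ∧ z.1 i < R.corner i + R.side) ∧
    R.bottom ≤ z.2 ∧ z.2 < R.bottom + R.lt p}

/-- Lebesgue measure `|R|`. -/
def vol (p : ℝ) (R : PRect n) : ENNReal :=
  volume (R.toSet p)

/-- Temporal translation `R^θ(γ) = R(γ) + (0, θ l_t(R(γ)))`. -/
def shift (p θ : ℝ) (R : PRect n) : PRect n :=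
  { R with bottom := R.bottom + θ * R.lt p }

/-- Number of temporal subdivisions of a rectangle with truncation parameter `γ`. -/
def timeDiv (p : ℝ) (d : ℕ) (γ : ℝ) : ℕ :=
  if γ ≤ 1 - ((2 : ℝ) ^ (d * p) + 1) / (2 : ℝ) ^ (d * p + 1) then
    ⌈(2 : ℝ) ^ (d * p)⌉₊
  else
    ⌊(2 : ℝ) ^ (d * p)⌋₊

/-- The dyadic child with spatial position `a` and temporal position `b`.  Its truncation parameter
`α` is the one for which `(1 - α) (L / 2 ^ d) ^ p` is the `k`-th part of `l_t(R(γ))`. -/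
def child (p : ℝ) (d : ℕ) (R : PRect n) (a : Fin n → Fin (2 ^ d))
    (b : Fin (timeDiv p d R.trunc)) : PRect n where
  corner := fun i => R.corner i + (a i : ℕ) * (R.side / 2 ^ d)
  bottom := R.bottom + (b : ℕ) * (R.lt p / timeDiv p d R.trunc)
  side := R.side / 2 ^ d
  trunc := 1 - (1 - R.trunc) * ((2 : ℝ) ^ (d * p) / timeDiv p d R.trunc)

/-- First dyadic layer `𝒟₁(R(γ))`. -/
def children (p : ℝ) (d : ℕ) (R : PRect n) : Set (PRect n) :=
  {P | ∃ a b, P = child p d R a b}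

/-- The dyadic layer `𝒟ᵢ(R(γ))`. -/
def layer (p : ℝ) (d : ℕ) (R : PRect n) : ℕ → Set (PRect n)
  | 0 => {R}
  | i + 1 => ⋃ P ∈ layer p d R i, children p d P

/-- The dyadic lattice `𝒟(R(γ))`. -/
def lattice (p : ℝ) (d : ℕ) (R : PRect n) : Set (PRect n) :=
  ⋃ i, layer p d R i

/-- The layer `𝒟ᵢᵉˣᵗ(R(γ))` of the lattice extended to the time-strip over `R(γ)`. -/
def extLayer (p : ℝ) (d : ℕ) (R : PRect n) (i : ℕ) : Set (PRect n) :=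
  ⋃ j : ℤ, layer p d (R.shift p j) i

/-- The extended dyadic lattice `𝒟ᵉˣᵗ(R(γ))`. -/
def extLattice (p : ℝ) (d : ℕ) (R : PRect n) : Set (PRect n) :=
  ⋃ i, extLayer p d R i

open Classical in
/-- The dyadic parent `π P` of `P` in the extended lattice of `R`.  It is unique if it exists;
rectangles without a parent are mapped to themselves, a value that is never used below. -/
def parent (p : ℝ) (d : ℕ) (R P : PRect n) : PRect n :=
  if h : ∃ Q ∈ extLattice p d R, P ∈ children p d Q then h.choose else P

/-- The forward-in-time parent `π⁺ P = (π P)^θ₀`; its iterates are the `πᵢ⁺`. -/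
def fwdParent (p : ℝ) (d : ℕ) (θ₀ : ℤ) (R P : PRect n) : PRect n :=
  (parent p d R P).shift p θ₀

/-- `P` is `E`-free. -/
def Free (p : ℝ) (E : Set ((Fin n → ℝ) × ℝ)) (P : PRect n) : Prop :=
  P.toSet p ∩ E = ∅

/-- The collection `ℱ(R(γ))` of the rectangles `P_z`, `z ∈ R(γ) \ E`, where `P_z` is the maximal
`E`-free rectangle in `𝒟(R(γ))` that contains `z`. -/
def maxFree (p : ℝ) (d : ℕ) (E : Set ((Fin n → ℝ) × ℝ)) (R : PRect n) : Set (PRect n) :=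
  {P | ∃ z ∈ R.toSet p \ E, P ∈ lattice p d R ∧ Free p E P ∧ z ∈ P.toSet p ∧
    ∀ Q ∈ lattice p d R, Free p E Q → z ∈ Q.toSet p → Q.toSet p ⊆ P.toSet p}

open Classical in
/-- The maximal hole `ℳ(R(γ))`: a member of `ℱ(R(γ))` of largest side length (they exist as soon as
`ℱ(R(γ))` is nonempty, and all have the same measure), and `∅` if `ℱ(R(γ))` is empty. -/
def maxHole (p : ℝ) (d : ℕ) (E : Set ((Fin n → ℝ) × ℝ)) (R : PRect n) :
    Set ((Fin n → ℝ) × ℝ) :=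
  if h : ∃ M ∈ maxFree p d E R, ∀ P ∈ maxFree p d E R, P.side ≤ M.side then
    h.choose.toSet p
  else ∅

/-- The measure `|ℳ(R(γ))|`. -/
def holeVol (p : ℝ) (d : ℕ) (E : Set ((Fin n → ℝ) × ℝ)) (R : PRect n) : ENNReal :=
  volume (maxHole p d E R)

/-- The collection `ℱ_δ^θ(R(γ))` of the maximal `δ`-admissible rectangles. -/
def maxAdm (p : ℝ) (d : ℕ) (E : Set ((Fin n → ℝ) × ℝ)) (δ θ : ℝ) (R : PRect n) :
    Set (PRect n) :=
  {P ∈ maxFree p d E R | ENNReal.ofReal δ * holeVol p d E (R.shift p θ) ≤ P.vol p}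

/-- The union `F_δ^θ` of `ℱ_δ^θ(R(γ))`. -/
def admUnion (p : ℝ) (d : ℕ) (E : Set ((Fin n → ℝ) × ℝ)) (δ θ : ℝ) (R : PRect n) :
    Set ((Fin n → ℝ) × ℝ) :=
  ⋃ Q ∈ maxAdm p d E δ θ R, Q.toSet p

/-- The collection `𝒢_δ^θ(R(γ))` of the maximal complementary rectangles.  (`R` itself, which has no
parent, does not belong to it.) -/
def complRects (p : ℝ) (d : ℕ) (E : Set ((Fin n → ℝ) × ℝ)) (δ θ : ℝ) (R : PRect n) :
    Set (PRect n) :=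
  {P ∈ lattice p d R | P.toSet p ∩ admUnion p d E δ θ R = ∅ ∧
    ((parent p d R P).toSet p ∩ admUnion p d E δ θ R).Nonempty}

/-- The stopping time `τ_Λ(P)` for `P ∈ 𝒟ₘᵉˣᵗ(R)`: the least `k ∈ {1, …, m}` such that
`|ℳ(π_k⁺ P^θ)| ≥ Λ` for some real `θ ∈ [φ - θ₀, Φ - θ₀]`.  The value `⊤` means that `τ_Λ(P)` is not
defined. -/
def stopTime (p : ℝ) (d : ℕ) (θ₀ φ Φ : ℤ) (E : Set ((Fin n → ℝ) × ℝ)) (R : PRect n)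
    (Λ : ENNReal) (P : PRect n) : ℕ∞ :=
  sInf {κ : ℕ∞ | ∃ k m : ℕ, κ = k ∧ P ∈ extLayer p d R m ∧ 1 ≤ k ∧ k ≤ m ∧
    ∃ θ ∈ Set.Icc ((φ : ℝ) - θ₀) ((Φ : ℝ) - θ₀),
      Λ ≤ holeVol p d E (((fwdParent p d θ₀ R)^[k] P).shift p θ)}

/-- The collections `𝒮_k(𝒜, Λ)`: all `Q = πᵢ⁺ P` with `P ∈ 𝒜`, `0 ≤ i ≤ τ_Λ(P) - 1` and
`τ_Λ(Q) = k`. -/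
def stopColl (p : ℝ) (d : ℕ) (θ₀ φ Φ : ℤ) (E : Set ((Fin n → ℝ) × ℝ)) (R : PRect n)
    (A : Set (PRect n)) (Λ : ENNReal) (k : ℕ) : Set (PRect n) :=
  {Q | ∃ P ∈ A, ∃ i : ℕ, stopTime p d θ₀ φ Φ E R Λ P ≠ ⊤ ∧
    (i : ℕ∞) < stopTime p d θ₀ φ Φ E R Λ P ∧
    Q = (fwdParent p d θ₀ R)^[i] P ∧ stopTime p d θ₀ φ Φ E R Λ Q = k}

/-- The collections `𝒮_k = 𝒮_k(𝒢_δ^Φ(R), Λ)` with `Λ = δ |ℳ(R^Φ)|`. -/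
def stopS (p : ℝ) (d : ℕ) (θ₀ φ Φ : ℤ) (E : Set ((Fin n → ℝ) × ℝ)) (δ : ℝ) (R : PRect n)
    (k : ℕ) : Set (PRect n) :=
  stopColl p d θ₀ φ Φ E R (complRects p d E δ Φ R)
    (ENNReal.ofReal δ * holeVol p d E (R.shift p Φ)) k

end PRect

/-- `E` is a nonempty closed `(c, δ, θ)`-weakly porous set (for division rate `d`). -/
structure IsWeaklyPorous {n : ℕ} (p : ℝ) (d : ℕ) (E : Set ((Fin n → ℝ) × ℝ)) (c δ θ : ℝ) :
    Prop where
  nonempty : E.Nonempty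
  closed : IsClosed E
  c_mem : c ∈ Set.Ioo (0 : ℝ) 1
  δ_mem : δ ∈ Set.Ioo (0 : ℝ) 1
  porous : ∀ R : PRect n, R.Valid → ∃ (N : ℕ) (P : Fin N → PRect n),
    (∀ k, P k ∈ R.lattice p d) ∧
    (∀ k l, k ≠ l → Disjoint ((P k).toSet p) ((P l).toSet p)) ∧
    (∀ k, (P k).Free p E) ∧
    (∀ k, ENNReal.ofReal δ * (R.shift p θ).holeVol p d E ≤ (P k).vol p) ∧
    ENNReal.ofReal c * R.vol p ≤ ∑ k, (P k).vol p

/-- The conditions under which the integer parameters `θ₀, φ, Φ` are fixed. -/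
structure ParamsOK (p : ℝ) (d : ℕ) (θ₀ φ Φ : ℤ) : Prop where
  two_le_θ₀ : 2 ≤ θ₀
  two_le_φ : 2 ≤ φ
  two_le_Φ : 2 ≤ Φ
  cond₁ : φ ≤ Φ - θ₀ - ⌈2 * (θ₀ : ℝ) / ((2 : ℝ) ^ (d * p) - 1)⌉
  cond₂ : φ ≤ θ₀ ∧ θ₀ ≤ Φ
  cond₃ : ⌈(2 : ℝ) ^ (d * p)⌉ - 1 ≤ Φ
  cond₄ : φ ≤ ⌊(2 : ℝ) ^ (d * p)⌋ - 1 - θ₀ - ⌈2 * (θ₀ : ℝ) / ((2 : ℝ) ^ (d * p) - 1)⌉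
  cond₅ : φ - θ₀ ≤ -⌈4 * (θ₀ : ℝ) / ((2 : ℝ) ^ (d * p) - 1)⌉

end

/-! Every rectangle of the extended lattice is a `cell` of one nested grid on space-time, given by a
level, a spatial coordinate vector and a time coordinate. Taking parents is floor division of the
coordinates, and translating by an integer number of durations is addition in the time coordinate.
Nesting and overlap questions thus become integer arithmetic.

The carrying notion is `Hanging`: a cell whose holes are below Λ at every lag in [φ - θ₀, Φ - θ₀],
while the cell s steps earlier, 0 ≤ s ≤ θ₀ + 1, has a hole of measure at least Λ. The parent of a
complementary rectangle contains an admissible hole, and this remains true of an ancestor a few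
steps in the past along the iterates of π⁺: floor division turns a gap s into 0 or 1, and the
forward shift then adds θ₀. So all iterates π_i⁺ with 1 ≤ i < τ are hanging (`hanging_iterate`).

Distinct hanging cells are disjoint: if the finer one lies in the coarser one U, its past hole lies
in U or in the predecessor of U, and both lags 0 and -1 are admissible. This is (ii), since forward
parents of members of 𝒮_{k+1} are hanging members of 𝒮_k.

For (i), members of 𝒮_k have holes below Λ only. In a full family of siblings, the latest one is
either complementary, so some sibling has a large hole, or hanging, and then the cell s steps
earlier is a sibling with a large hole; both are impossible.

For (iii), (i) shows that each fibre of π⁺ on 𝒮_{k+1} misses a fixed fraction of its parent, whose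
measure is that of the forward parent. Summing over the disjoint forward parents gives a factor λ
per generation. -/

noncomputable section

namespace PRect

/-! ### The extended lattice as an integer grid -/

variable {n : ℕ}

/-- Nondegeneracy of the data of a parabolic rectangle. -/
def Pos (R : PRect n) : Prop := 0 < R.side ∧ R.trunc < 1

/-- Truncation parameter of the rectangles in the `i`-th dyadic layer. -/
def genTrunc (p : ℝ) (d : ℕ) (γ : ℝ) : ℕ → ℝ
  | 0 => γ
  | i + 1 => 1 - (1 - genTrunc p d γ i) * ((2 : ℝ) ^ (d * p) / timeDiv p d (genTrunc p d γ i))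

/-- Number of temporal subdivisions of the rectangles in the `i`-th dyadic layer. -/
def genDiv (p : ℝ) (d : ℕ) (γ : ℝ) (i : ℕ) : ℕ := timeDiv p d (genTrunc p d γ i)

/-- Number of temporal subdivisions between the layers `i` and `i + j`. -/
def divProd (p : ℝ) (d : ℕ) (γ : ℝ) (i : ℕ) : ℕ → ℕ
  | 0 => 1
  | j + 1 => divProd p d γ i j * genDiv p d γ (i + j)

/-- Temporal side length of the rectangles in the `i`-th dyadic layer. -/
def genDur (p : ℝ) (d : ℕ) (R : PRect n) (i : ℕ) : ℝ :=
  (1 - genTrunc p d R.trunc i) * (R.side / (2 ^ d) ^ i) ^ p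

/-- The cell with integer coordinates `a` and `b` in the `i`-th layer of the dyadic grid of `R`,
extended to all of space-time. -/
def cell (p : ℝ) (d : ℕ) (R : PRect n) (i : ℕ) (a : Fin n → ℤ) (b : ℤ) : PRect n where
  corner := fun k => R.corner k + a k * (R.side / (2 ^ d) ^ i)
  bottom := R.bottom + b * genDur p d R i
  side := R.side / (2 ^ d) ^ i
  trunc := genTrunc p d R.trunc i

variable {p : ℝ} {d : ℕ}

theorem lt_pos {R : PRect n} (hR : R.Pos) : 0 < R.lt p :=
  mul_pos (sub_pos.2 hR.2) (Real.rpow_pos_of_pos hR.1 _)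

theorem timeDiv_pos (hD : (9 : ℝ) ≤ 2 ^ (d * p)) (γ : ℝ) : 0 < timeDiv p d γ := by
  unfold timeDiv
  split_ifs
  · exact Nat.ceil_pos.2 (by linarith)
  · exact Nat.floor_pos.2 (by linarith)

theorem floor_le_timeDiv (γ : ℝ) : ⌊(2 : ℝ) ^ (d * p)⌋₊ ≤ timeDiv p d γ := by
  unfold timeDiv
  split_ifs
  · exact Nat.floor_le_ceil _
  · exact le_rfl

theorem timeDiv_le_ceil (γ : ℝ) : timeDiv p d γ ≤ ⌈(2 : ℝ) ^ (d * p)⌉₊ := by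
  unfold timeDiv
  split_ifs
  · exact le_rfl
  · exact Nat.floor_le_ceil _

theorem genDiv_pos (hD : (9 : ℝ) ≤ 2 ^ (d * p)) (γ : ℝ) (i : ℕ) : 0 < genDiv p d γ i :=
  timeDiv_pos hD _

theorem divProd_pos (hD : (9 : ℝ) ≤ 2 ^ (d * p)) (γ : ℝ) (i j : ℕ) : 0 < divProd p d γ i j := by
  induction j with
  | zero => exact one_pos
  | succ j ih => exact Nat.mul_pos ih (genDiv_pos hD _ _)

theorem genTrunc_lt_one (hD : (9 : ℝ) ≤ 2 ^ (d * p)) {γ : ℝ} (hγ : γ < 1) (i : ℕ) :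
    genTrunc p d γ i < 1 := by
  induction i with
  | zero => exact hγ
  | succ i ih =>
    have hK : (0 : ℝ) < timeDiv p d (genTrunc p d γ i) := by exact_mod_cast timeDiv_pos hD _
    have : 0 < (1 - genTrunc p d γ i) *
        ((2 : ℝ) ^ (d * p) / timeDiv p d (genTrunc p d γ i)) :=
      mul_pos (sub_pos.2 ih) (div_pos (by linarith) hK)
    simp only [genTrunc]
    linarith

theorem genDur_pos (hD : (9 : ℝ) ≤ 2 ^ (d * p)) {R : PRect n} (hR : R.Pos) (i : ℕ) :
    0 < genDur p d R i :=
  mul_pos (sub_pos.2 (genTrunc_lt_one hD hR.2 i))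
    (Real.rpow_pos_of_pos (div_pos hR.1 (by positivity)) _)

theorem two_pow_rpow : (((2 : ℝ) ^ d) ^ p) = (2 : ℝ) ^ (d * p) := by
  rw [← Real.rpow_natCast, ← Real.rpow_mul (by norm_num)]

theorem genDur_succ {R : PRect n} (hR : R.Pos) (i : ℕ) :
    genDur p d R (i + 1) = genDur p d R i / genDiv p d R.trunc i := by
  have h2 : (0 : ℝ) < 2 ^ (d * p) := by positivity
  unfold genDur genDiv
  rw [pow_succ, ← div_div, Real.div_rpow (div_pos hR.1 (by positivity)).le (by positivity),
    two_pow_rpow]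
  simp only [genTrunc]
  field_simp
  ring

theorem genDur_eq_mul (hD : (9 : ℝ) ≤ 2 ^ (d * p)) {R : PRect n} (hR : R.Pos) (i j : ℕ) :
    genDur p d R i = divProd p d R.trunc i j * genDur p d R (i + j) := by
  induction j with
  | zero => simp [divProd]
  | succ j ih =>
    have hK : (0 : ℝ) < genDiv p d R.trunc (i + j) := by exact_mod_cast genDiv_pos hD _ _
    rw [ih, ← add_assoc, genDur_succ hR, divProd]
    push_cast
    field_simp

@[simp] theorem cell_lt (R : PRect n) (i : ℕ) (a : Fin n → ℤ) (b : ℤ) :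
    (cell p d R i a b).lt p = genDur p d R i := rfl

theorem cell_pos (hD : (9 : ℝ) ≤ 2 ^ (d * p)) {R : PRect n} (hR : R.Pos) (i : ℕ) (a : Fin n → ℤ)
    (b : ℤ) : (cell p d R i a b).Pos :=
  ⟨div_pos hR.1 (by positivity), genTrunc_lt_one hD hR.2 i⟩

theorem shift_cell (R : PRect n) (i : ℕ) (a : Fin n → ℤ) (b r : ℤ) :
    (cell p d R i a b).shift p r = cell p d R i a (b + r) := by
  ext1 <;> simp only [shift, cell_lt] <;> simp only [cell]
  push_cast
  ring

theorem shift_eq_cell (R : PRect n) (j : ℤ) : R.shift p j = cell p d R 0 0 j := by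
  ext1 <;> simp [shift, cell, genDur, genTrunc, PRect.lt]

theorem self_eq_cell (R : PRect n) : R = cell p d R 0 0 0 := by
  ext1 <;> simp [cell, genTrunc]

theorem side_strictAnti {R : PRect n} (hd : 1 ≤ d) (hR : R.Pos) :
    StrictAnti fun i : ℕ => R.side / ((2 : ℝ) ^ d) ^ i := by
  intro i j hij
  have : (1 : ℝ) < 2 ^ d := one_lt_pow₀ (by norm_num) (by omega)
  exact div_lt_div_of_pos_left hR.1 (by positivity) (pow_lt_pow_right₀ this hij)

/-- Side lengths strictly decrease with the level, so the side determines the level; corner and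
bottom then determine the coordinates. -/
theorem cell_injective (hD : (9 : ℝ) ≤ 2 ^ (d * p)) (hd : 1 ≤ d) {R : PRect n} (hR : R.Pos)
    {i i' : ℕ} {a a' : Fin n → ℤ} {b b' : ℤ} (h : cell p d R i a b = cell p d R i' a' b') :
    i = i' ∧ a = a' ∧ b = b' := by
  have hi : i = i' := (side_strictAnti hd hR).injective (congrArg PRect.side h)
  subst hi
  refine ⟨rfl, ?_, ?_⟩
  · funext k
    have hs : R.side / ((2 : ℝ) ^ d) ^ i ≠ 0 := (div_pos hR.1 (by positivity)).ne'
    have := congrFun (congrArg PRect.corner h) k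
    simpa [cell, hR.1.ne'] using this
  · have := congrArg PRect.bottom h
    simpa [cell, (genDur_pos hD hR i).ne'] using this

/-- Positions within a parent are the remainders of the child's coordinates modulo the numbers of
subdivisions; the parent's coordinates are the quotients. -/
theorem mem_children_cell (hD : (9 : ℝ) ≤ 2 ^ (d * p)) {R : PRect n} (hR : R.Pos)
    {i : ℕ} {a : Fin n → ℤ} {b : ℤ} {X : PRect n} :
    X ∈ children p d (cell p d R i a b) ↔ ∃ a' b', X = cell p d R (i + 1) a' b' ∧
      (∀ k, a' k / (2 ^ d : ℤ) = a k) ∧ b' / (genDiv p d R.trunc i : ℤ) = b := by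
  have hK : 0 < genDiv p d R.trunc i := genDiv_pos hD _ _
  have hKr : (0 : ℝ) < genDiv p d R.trunc i := by exact_mod_cast hK
  have h2 : (0 : ℤ) < 2 ^ d := by positivity
  constructor
  · rintro ⟨x, y, rfl⟩
    refine ⟨fun k => a k * 2 ^ d + (x k : ℕ), b * genDiv p d R.trunc i + (y : ℕ), ?_, ?_, ?_⟩
    · ext1
      · funext k
        simp only [child, cell]
        push_cast
        field_simp
        ring
      · simp only [child, cell_lt]
        simp only [cell]
        rw [genDur_succ hR]
        change _ + _ + _ * (_ / ((genDiv p d R.trunc i : ℕ) : ℝ)) = _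
        push_cast
        field_simp
        ring
      · simp only [child, cell]
        rw [pow_succ, div_div]
      · rfl
    · intro k
      have hx : ((x k : ℕ) : ℤ) < 2 ^ d := by exact_mod_cast (x k).2
      beta_reduce
      rw [add_comm, Int.add_mul_ediv_right _ _ h2.ne', Int.ediv_eq_zero_of_lt (by positivity) hx,
        zero_add]
    · have hy : ((y : ℕ) : ℤ) < genDiv p d R.trunc i := by exact_mod_cast y.2
      rw [add_comm, Int.add_mul_ediv_right _ _ (by exact_mod_cast hK.ne'),
        Int.ediv_eq_zero_of_lt (by positivity) hy, zero_add]
  · rintro ⟨a', b', rfl, ha, hb⟩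
    have hKz : (0 : ℤ) < genDiv p d R.trunc i := by exact_mod_cast hK
    refine ⟨fun k => ⟨(a' k % 2 ^ d).toNat, ?_⟩, ⟨(b' % genDiv p d R.trunc i).toNat, ?_⟩, ?_⟩
    · have := Int.emod_lt_of_pos (a' k) h2
      have h0 := Int.emod_nonneg (a' k) h2.ne'
      zify
      rw [Int.toNat_of_nonneg h0]
      exact_mod_cast this
    · have := Int.emod_lt_of_pos b' hKz
      have h0 := Int.emod_nonneg b' hKz.ne'
      change _ < genDiv p d R.trunc i
      zify
      rwa [Int.toNat_of_nonneg h0]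
    · have key : ∀ x m : ℤ, 0 < m → (((x % m).toNat : ℕ) : ℝ) = x - (x / m : ℤ) * m := by
        intro x m hm
        have h0 := Int.emod_nonneg x hm.ne'
        have h1 : (((x % m).toNat : ℕ) : ℤ) = x - (x / m) * m := by
          rw [Int.toNat_of_nonneg h0, Int.emod_def, mul_comm]
        exact_mod_cast congrArg (Int.cast : ℤ → ℝ) h1
      ext1
      · funext k
        simp only [child, cell]
        rw [key _ _ h2, ha k]
        push_cast
        field_simp
        ring
      · simp only [child, cell_lt]
        simp only [cell]
        rw [genDur_succ hR, key _ _ hKz, hb]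
        change _ = _ + _ + _ * (_ / ((genDiv p d R.trunc i : ℕ) : ℝ))
        push_cast
        field_simp
        ring
      · simp only [child, cell]
        rw [pow_succ, div_div]
      · rfl

theorem mem_layer_cell (hD : (9 : ℝ) ≤ 2 ^ (d * p)) {R : PRect n} (hR : R.Pos)
    {i j : ℕ} {a : Fin n → ℤ} {b : ℤ} {X : PRect n} :
    X ∈ layer p d (cell p d R i a b) j ↔ ∃ a' b', X = cell p d R (i + j) a' b' ∧
      (∀ k, a' k / (2 ^ d : ℤ) ^ j = a k) ∧ b' / (divProd p d R.trunc i j : ℤ) = b := by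
  induction j generalizing X with
  | zero =>
    constructor
    · rintro rfl
      exact ⟨a, b, rfl, by simp, by simp [divProd]⟩
    · rintro ⟨a', b', rfl, ha, hb⟩
      have h1 : a' = a := funext fun k => by simpa using ha k
      have h2 : b' = b := by simpa [divProd] using hb
      rw [h1, h2]
      rfl
  | succ j ih =>
    simp only [layer, Set.mem_iUnion]
    have e1 : ∀ x : ℤ, x / (2 ^ d : ℤ) ^ (j + 1) = x / 2 ^ d / (2 ^ d) ^ j := fun x => by
      rw [pow_succ', Int.ediv_ediv_of_nonneg (by positivity)]
    have e2 : ∀ x : ℤ, x / (divProd p d R.trunc i (j + 1) : ℤ) =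
        x / genDiv p d R.trunc (i + j) / divProd p d R.trunc i j := fun x => by
      rw [Int.ediv_ediv_of_nonneg (by positivity), divProd, mul_comm]
      push_cast
      rfl
    constructor
    · rintro ⟨Y, hY, hX⟩
      obtain ⟨a₁, b₁, rfl, ha₁, hb₁⟩ := ih.1 hY
      obtain ⟨a₂, b₂, rfl, ha₂, hb₂⟩ := (mem_children_cell hD hR).1 hX
      exact ⟨a₂, b₂, rfl, fun k => by rw [e1, ha₂, ha₁], by rw [e2, hb₂, hb₁]⟩
    · rintro ⟨a', b', rfl, ha, hb⟩
      exact ⟨cell p d R (i + j) (fun k => a' k / 2 ^ d) (b' / genDiv p d R.trunc (i + j)),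
        ih.2 ⟨_, _, rfl, fun k => by rw [← e1, ha], by rw [← e2, hb]⟩,
        (mem_children_cell hD hR).2 ⟨_, _, rfl, fun k => rfl, rfl⟩⟩

theorem mem_layer (hD : (9 : ℝ) ≤ 2 ^ (d * p)) {R : PRect n} (hR : R.Pos) {j : ℕ} {X : PRect n} :
    X ∈ layer p d R j ↔ ∃ a b, X = cell p d R j a b ∧
      (∀ k, a k / (2 ^ d : ℤ) ^ j = 0) ∧ b / (divProd p d R.trunc 0 j : ℤ) = 0 := by
  have := mem_layer_cell hD hR (i := 0) (j := j) (a := 0) (b := 0) (X := X)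
  rw [← self_eq_cell, zero_add] at this
  exact this

theorem mem_extLayer (hD : (9 : ℝ) ≤ 2 ^ (d * p)) {R : PRect n} (hR : R.Pos) {i : ℕ}
    {X : PRect n} :
    X ∈ extLayer p d R i ↔ ∃ a b, X = cell p d R i a b ∧ ∀ k, a k / (2 ^ d : ℤ) ^ i = 0 := by
  simp only [extLayer, Set.mem_iUnion, shift_eq_cell (d := d), mem_layer_cell hD hR, zero_add]
  constructor
  · rintro ⟨_, a, b, h, ha, _⟩
    exact ⟨a, b, h, ha⟩
  · rintro ⟨a, b, h, ha⟩
    exact ⟨_, a, b, h, ha, rfl⟩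

theorem layer_subset_extLayer (R : PRect n) (i : ℕ) : layer p d R i ⊆ extLayer p d R i := by
  intro X hX
  refine Set.mem_iUnion.2 ⟨0, ?_⟩
  have : R.shift p ((0 : ℤ) : ℝ) = R := by ext1 <;> simp [shift]
  rwa [this]

theorem extLayer_unique (hD : (9 : ℝ) ≤ 2 ^ (d * p)) (hd : 1 ≤ d) {R : PRect n} (hR : R.Pos)
    {i j : ℕ} {X : PRect n} (hi : X ∈ extLayer p d R i) (hj : X ∈ extLayer p d R j) : i = j := by
  obtain ⟨a, b, rfl, _⟩ := (mem_extLayer hD hR).1 hi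
  obtain ⟨a', b', h, _⟩ := (mem_extLayer hD hR).1 hj
  exact (cell_injective hD hd hR h).1

/-- The parent is picked by choice; injectivity of the cell coordinates forces the choice. -/
theorem parent_cell (hD : (9 : ℝ) ≤ 2 ^ (d * p)) (hd : 1 ≤ d) {R : PRect n} (hR : R.Pos)
    {i : ℕ} {a : Fin n → ℤ} {b : ℤ} (h : cell p d R (i + 1) a b ∈ extLayer p d R (i + 1)) :
    parent p d R (cell p d R (i + 1) a b) =
      cell p d R i (fun k => a k / 2 ^ d) (b / genDiv p d R.trunc i) := by
  have hex : ∃ Q ∈ extLattice p d R, cell p d R (i + 1) a b ∈ children p d Q := by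
    obtain ⟨j, hj⟩ := Set.mem_iUnion.1 h
    simp only [layer, Set.mem_iUnion] at hj
    obtain ⟨Q, hQ, hc⟩ := hj
    exact ⟨Q, Set.mem_iUnion.2 ⟨i, Set.mem_iUnion.2 ⟨j, hQ⟩⟩, hc⟩
  rw [parent, dif_pos hex]
  obtain ⟨hQ, hc⟩ := hex.choose_spec
  obtain ⟨l, hl⟩ := Set.mem_iUnion.1 hQ
  obtain ⟨a₁, b₁, hQe, _⟩ := (mem_extLayer hD hR).1 hl
  rw [hQe] at hc ⊢
  obtain ⟨a₂, b₂, he, ha, hb⟩ := (mem_children_cell hD hR).1 hc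
  obtain ⟨h1, rfl, rfl⟩ := cell_injective hD hd hR he
  obtain rfl : i = l := by omega
  rw [← hb, ← funext ha]

theorem parent_mem_extLayer (hD : (9 : ℝ) ≤ 2 ^ (d * p)) (hd : 1 ≤ d) {R : PRect n} (hR : R.Pos)
    {i : ℕ} {X : PRect n} (h : X ∈ extLayer p d R (i + 1)) :
    parent p d R X ∈ extLayer p d R i ∧ X ∈ children p d (parent p d R X) := by
  obtain ⟨a, b, rfl, ha⟩ := (mem_extLayer hD hR).1 h
  rw [parent_cell hD hd hR h]
  refine ⟨(mem_extLayer hD hR).2 ⟨_, _, rfl, fun k => ?_⟩,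
    (mem_children_cell hD hR).2 ⟨_, _, rfl, fun k => rfl, rfl⟩⟩
  rw [Int.ediv_ediv_of_nonneg (by positivity), ← pow_succ', ha]

theorem fwdParent_mem_extLayer (hD : (9 : ℝ) ≤ 2 ^ (d * p)) (hd : 1 ≤ d) {R : PRect n}
    (hR : R.Pos) (θ₀ : ℤ) {i : ℕ} {X : PRect n} (h : X ∈ extLayer p d R (i + 1)) :
    fwdParent p d θ₀ R X ∈ extLayer p d R i := by
  obtain ⟨a, b, he, ha⟩ := (mem_extLayer hD hR).1 (parent_mem_extLayer hD hd hR h).1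
  rw [fwdParent, he, shift_cell]
  exact (mem_extLayer hD hR).2 ⟨_, _, rfl, ha⟩

/-! ### Points, cells and nesting -/

theorem mem_toSet_cell (hD : (9 : ℝ) ≤ 2 ^ (d * p)) {R : PRect n} (hR : R.Pos) {i : ℕ}
    {a : Fin n → ℤ} {b : ℤ} {z : (Fin n → ℝ) × ℝ} :
    z ∈ (cell p d R i a b).toSet p ↔
      (∀ k, ⌊(z.1 k - R.corner k) / (R.side / (2 ^ d) ^ i)⌋ = a k) ∧
        ⌊(z.2 - R.bottom) / genDur p d R i⌋ = b := by
  have hs : 0 < R.side / ((2 : ℝ) ^ d) ^ i := div_pos hR.1 (by positivity)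
  have ht := genDur_pos hD hR i
  have key : ∀ (x c w : ℝ) (m : ℤ), 0 < w →
      (⌊(x - c) / w⌋ = m ↔ c + m * w ≤ x ∧ x < c + m * w + w) := by
    intro x c w m hw
    rw [Int.floor_eq_iff, le_div_iff₀ hw, div_lt_iff₀ hw]
    constructor <;> rintro ⟨h1, h2⟩ <;> constructor <;> linarith
  simp only [toSet, Set.mem_ofPred_eq, cell_lt, key _ _ _ _ hs, key _ _ _ _ ht]
  rfl

/-- Rests on ⌊x / m⌋ = ⌊x⌋ / m for a natural number m: the coarse coordinates of a point depend only
on its fine ones. -/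
theorem mem_toSet_cell_iff_of_mem (hD : (9 : ℝ) ≤ 2 ^ (d * p)) {R : PRect n} (hR : R.Pos)
    {i j : ℕ} {a a' : Fin n → ℤ} {b b' : ℤ} {z : (Fin n → ℝ) × ℝ}
    (hz : z ∈ (cell p d R (i + j) a' b').toSet p) :
    z ∈ (cell p d R i a b).toSet p ↔
      (∀ k, a' k / (2 ^ d : ℤ) ^ j = a k) ∧ b' / (divProd p d R.trunc i j : ℤ) = b := by
  rw [mem_toSet_cell hD hR] at hz ⊢
  have h1 : ∀ k, ⌊(z.1 k - R.corner k) / (R.side / ((2 : ℝ) ^ d) ^ i)⌋ =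
      a' k / (2 ^ d : ℤ) ^ j := by
    intro k
    have : (z.1 k - R.corner k) / (R.side / ((2 : ℝ) ^ d) ^ i) =
        (z.1 k - R.corner k) / (R.side / ((2 : ℝ) ^ d) ^ (i + j)) / (((2 ^ d) ^ j : ℕ) : ℝ) := by
      have := hR.1.ne'
      push_cast
      rw [pow_add]
      field_simp
    rw [this, Int.floor_div_natCast, hz.1 k]
    push_cast
    rfl
  have h2 : ⌊(z.2 - R.bottom) / genDur p d R i⌋ = b' / (divProd p d R.trunc i j : ℤ) := by
    have hP : (0 : ℝ) < divProd p d R.trunc i j := by exact_mod_cast divProd_pos hD _ _ _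
    have : (z.2 - R.bottom) / genDur p d R i =
        (z.2 - R.bottom) / genDur p d R (i + j) / (divProd p d R.trunc i j : ℝ) := by
      have := (genDur_pos hD hR (i + j)).ne'
      rw [genDur_eq_mul hD hR i j]
      field_simp
    rw [this, Int.floor_div_natCast, hz.2]
  simp only [h1, h2]

/-- Cells of the extended grid are nested. -/
theorem mem_layer_of_mem_of_mem (hD : (9 : ℝ) ≤ 2 ^ (d * p)) {R : PRect n} (hR : R.Pos)
    {i j : ℕ} {X Y : PRect n} (hij : i ≤ j) (hX : X ∈ extLayer p d R i)
    (hY : Y ∈ extLayer p d R j) {z : (Fin n → ℝ) × ℝ} (hzX : z ∈ X.toSet p)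
    (hzY : z ∈ Y.toSet p) : Y ∈ layer p d X (j - i) := by
  obtain ⟨m, rfl⟩ := Nat.exists_eq_add_of_le hij
  obtain ⟨a, b, rfl, _⟩ := (mem_extLayer hD hR).1 hX
  obtain ⟨a', b', rfl, _⟩ := (mem_extLayer hD hR).1 hY
  rw [Nat.add_sub_cancel_left]
  exact (mem_layer_cell hD hR).2 ⟨_, _, rfl, (mem_toSet_cell_iff_of_mem hD hR hzY).1 hzX⟩

theorem toSet_subset_of_mem_layer (hD : (9 : ℝ) ≤ 2 ^ (d * p)) {R : PRect n} (hR : R.Pos)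
    {j : ℕ} {X : PRect n} (hX : X ∈ layer p d R j) : X.toSet p ⊆ R.toSet p := by
  obtain ⟨a, b, rfl, h⟩ := (mem_layer hD hR).1 hX
  intro z hz
  rw [self_eq_cell (p := p) (d := d) R]
  rw [← zero_add j] at hz
  exact (mem_toSet_cell_iff_of_mem hD hR hz).2 h

theorem pos_of_mem_extLayer (hD : (9 : ℝ) ≤ 2 ^ (d * p)) {R : PRect n} (hR : R.Pos)
    {j : ℕ} {X : PRect n} (hX : X ∈ extLayer p d R j) : X.Pos := by
  obtain ⟨a, b, rfl, _⟩ := (mem_extLayer hD hR).1 hX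
  exact cell_pos hD hR _ _ _

theorem pos_of_mem_layer (hD : (9 : ℝ) ≤ 2 ^ (d * p)) {R : PRect n} (hR : R.Pos)
    {j : ℕ} {X : PRect n} (hX : X ∈ layer p d R j) : X.Pos :=
  pos_of_mem_extLayer hD hR (layer_subset_extLayer _ _ hX)

theorem layer_trans {R X Y : PRect n} {i j : ℕ} (hX : X ∈ layer p d R i)
    (hY : Y ∈ layer p d X j) : Y ∈ layer p d R (i + j) := by
  induction j generalizing Y with
  | zero => exact (show Y = X from hY) ▸ hX
  | succ j ih =>
    simp only [layer, Set.mem_iUnion] at hY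
    obtain ⟨Z, hZ, hYZ⟩ := hY
    rw [← add_assoc]
    simp only [layer, Set.mem_iUnion]
    exact ⟨Z, ih hZ, hYZ⟩

theorem mem_layer_one {R X : PRect n} : X ∈ layer p d R 1 ↔ X ∈ children p d R := by
  simp [layer]

theorem exists_child_of_mem_layer_succ {R X : PRect n} {i : ℕ}
    (hX : X ∈ layer p d R (i + 1)) : ∃ Q ∈ children p d R, X ∈ layer p d Q i := by
  induction i generalizing X with
  | zero => exact ⟨X, mem_layer_one.1 hX, rfl⟩
  | succ i ih =>
    rw [layer, Set.mem_iUnion₂] at hX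
    obtain ⟨Z, hZ, hXZ⟩ := hX
    obtain ⟨Q, hQ, hZQ⟩ := ih hZ
    refine ⟨Q, hQ, ?_⟩
    rw [layer, Set.mem_iUnion₂]
    exact ⟨Z, hZQ, hXZ⟩

/-! ### Volumes -/

theorem toSet_eq_prod (P : PRect n) :
    P.toSet p = (Set.univ.pi fun i => Set.Ico (P.corner i) (P.corner i + P.side)) ×ˢ
      Set.Ico P.bottom (P.bottom + P.lt p) := by
  ext z
  simp [toSet, Set.mem_prod, Set.mem_pi]

theorem measurableSet_toSet (P : PRect n) : MeasurableSet (P.toSet p) := by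
  rw [toSet_eq_prod]
  exact (MeasurableSet.univ_pi fun _ => measurableSet_Ico).prod measurableSet_Ico

theorem vol_eq (P : PRect n) :
    P.vol p = ENNReal.ofReal P.side ^ n * ENNReal.ofReal (P.lt p) := by
  rw [vol, toSet_eq_prod, Measure.volume_eq_prod, Measure.prod_prod, volume_pi_pi]
  simp

theorem vol_pos {P : PRect n} (hP : P.Pos) : 0 < P.vol p := by
  rw [vol_eq]
  exact ENNReal.mul_pos (pow_ne_zero n (ENNReal.ofReal_pos.2 hP.1).ne')
    (ENNReal.ofReal_pos.2 (lt_pos hP)).ne'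

theorem toSet_nonempty {P : PRect n} (hP : P.Pos) : (P.toSet p).Nonempty :=
  nonempty_of_measure_ne_zero (vol_pos hP).ne'

theorem vol_shift (P : PRect n) (θ : ℝ) : (P.shift p θ).vol p = P.vol p := by
  rw [vol_eq, vol_eq]
  rfl

theorem vol_le_vol_of_mem_layer (hD : (9 : ℝ) ≤ 2 ^ (d * p)) {R : PRect n} (hR : R.Pos)
    {i j : ℕ} (hij : i ≤ j) {X Y : PRect n} (hX : X ∈ layer p d R i) (hY : Y ∈ layer p d R j) :
    Y.vol p ≤ X.vol p := by
  obtain ⟨m, rfl⟩ := Nat.exists_eq_add_of_le hij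
  obtain ⟨a, b, rfl, _⟩ := (mem_layer hD hR).1 hX
  obtain ⟨a', b', rfl, _⟩ := (mem_layer hD hR).1 hY
  rw [vol_eq, vol_eq, cell_lt, cell_lt, genDur_eq_mul hD hR i m]
  have hs : R.side / ((2 : ℝ) ^ d) ^ (i + m) ≤ R.side / ((2 : ℝ) ^ d) ^ i :=
    div_le_div_of_nonneg_left hR.1.le (by positivity)
      (pow_le_pow_right₀ (one_le_pow₀ (by norm_num)) hij)
  have hP : (1 : ℝ) ≤ divProd p d R.trunc i m := by exact_mod_cast divProd_pos hD _ _ _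
  gcongr
  · exact hs
  · exact le_mul_of_one_le_left (genDur_pos hD hR _).le hP

/-! ### Maximal holes -/

/-- Take the first layer with a free rectangle containing z; by nesting it contains every other such
rectangle. -/
theorem exists_maxFree (hD : (9 : ℝ) ≤ 2 ^ (d * p)) {E : Set ((Fin n → ℝ) × ℝ)} {R Y : PRect n}
    (hR : R.Pos) (hY : Y ∈ lattice p d R) (hE : Free p E Y) {z : (Fin n → ℝ) × ℝ}
    (hz : z ∈ Y.toSet p) : ∃ M ∈ maxFree p d E R, z ∈ M.toSet p ∧ Y.toSet p ⊆ M.toSet p := by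
  classical
  have hex : ∃ j, ∃ X ∈ layer p d R j, Free p E X ∧ z ∈ X.toSet p := by
    obtain ⟨j, hj⟩ := Set.mem_iUnion.1 hY
    exact ⟨j, Y, hj, hE, hz⟩
  obtain ⟨M, hM, hME, hzM⟩ := Nat.find_spec hex
  have hmax : ∀ Q ∈ lattice p d R, Free p E Q → z ∈ Q.toSet p → Q.toSet p ⊆ M.toSet p := by
    intro Q hQ hQE hzQ
    obtain ⟨j, hj⟩ := Set.mem_iUnion.1 hQ
    exact toSet_subset_of_mem_layer hD (pos_of_mem_layer hD hR hM) (mem_layer_of_mem_of_mem hD hR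
      (Nat.find_min' hex ⟨Q, hj, hQE, hzQ⟩) (layer_subset_extLayer _ _ hM)
      (layer_subset_extLayer _ _ hj) hzM hzQ)
  refine ⟨M, ⟨z, ⟨toSet_subset_of_mem_layer hD hR hM hzM, fun hzE => ?_⟩,
    Set.mem_iUnion.2 ⟨_, hM⟩, hME, hzM, hmax⟩, hzM, hmax Y hY hE hz⟩
  exact (Set.eq_empty_iff_forall_notMem.1 hME) z ⟨hzM, hzE⟩

/-- A largest side exists because it corresponds to a least layer index. Volume also decreases along
layers, so a hole of largest side has largest volume. -/
theorem vol_le_holeVol (hD : (9 : ℝ) ≤ 2 ^ (d * p)) (hd : 1 ≤ d) {E : Set ((Fin n → ℝ) × ℝ)}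
    {R Y : PRect n} (hR : R.Pos) (hY : Y ∈ lattice p d R) (hE : Free p E Y) :
    Y.vol p ≤ holeVol p d E R := by
  classical
  obtain ⟨m, hm⟩ := Set.mem_iUnion.1 hY
  obtain ⟨z, hz⟩ := toSet_nonempty (p := p) (pos_of_mem_layer hD hR hm)
  obtain ⟨Y', hY', -, hsub⟩ := exists_maxFree hD hR hY hE hz
  have hlat : ∀ X ∈ maxFree p d E R, ∃ j, X ∈ layer p d R j := by
    rintro X ⟨_, _, hX, _⟩
    exact Set.mem_iUnion.1 hX
  have hside : ∀ {X j}, X ∈ layer p d R j → X.side = R.side / ((2 : ℝ) ^ d) ^ j := by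
    intro X j hX
    obtain ⟨a, b, rfl, _⟩ := (mem_layer hD hR).1 hX
    rfl
  have hex : ∃ j, ∃ X ∈ maxFree p d E R, X ∈ layer p d R j := by
    obtain ⟨j, hj⟩ := hlat Y' hY'
    exact ⟨j, Y', hY', hj⟩
  have hmax : ∃ M ∈ maxFree p d E R, ∀ P ∈ maxFree p d E R, P.side ≤ M.side := by
    obtain ⟨M, hM, hMl⟩ := Nat.find_spec hex
    refine ⟨M, hM, fun P hP => ?_⟩
    obtain ⟨j, hj⟩ := hlat P hP
    rw [hside hMl, hside hj]
    exact (side_strictAnti hd hR).antitone (Nat.find_min' hex ⟨P, hP, hj⟩)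
  rw [holeVol, maxHole, dif_pos hmax]
  obtain ⟨hM, hMs⟩ := hmax.choose_spec
  obtain ⟨i, hi⟩ := hlat _ hM
  obtain ⟨j, hj⟩ := hlat _ hY'
  have h := hMs _ hY'
  rw [hside hi, hside hj] at h
  have hij : i ≤ j := (side_strictAnti hd hR).le_iff_ge.1 h
  exact (measure_mono hsub).trans (vol_le_vol_of_mem_layer hD hR hij hi hj)

theorem exists_vol_eq_holeVol {E : Set ((Fin n → ℝ) × ℝ)} {R : PRect n}
    (h : 0 < holeVol p d E R) :
    ∃ M ∈ lattice p d R, Free p E M ∧ M.vol p = holeVol p d E R := by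
  classical
  by_cases hmax : ∃ M ∈ maxFree p d E R, ∀ P ∈ maxFree p d E R, P.side ≤ M.side
  · obtain ⟨⟨_, _, hM, hE, _⟩, _⟩ := hmax.choose_spec
    exact ⟨_, hM, hE, by rw [holeVol, maxHole, dif_pos hmax]; rfl⟩
  · rw [holeVol, maxHole, dif_neg hmax] at h
    simp at h

theorem holeVol_mono (hD : (9 : ℝ) ≤ 2 ^ (d * p)) (hd : 1 ≤ d) {E : Set ((Fin n → ℝ) × ℝ)}
    {R X : PRect n} (hR : R.Pos) {j : ℕ} (hX : X ∈ layer p d R j) :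
    holeVol p d E X ≤ holeVol p d E R := by
  rcases (bot_le : 0 ≤ holeVol p d E X).eq_or_lt with h | h
  · rw [← h]
    exact bot_le
  · obtain ⟨M, hM, hE, hv⟩ := exists_vol_eq_holeVol h
    obtain ⟨i, hi⟩ := Set.mem_iUnion.1 hM
    rw [← hv]
    exact vol_le_holeVol hD hd hR (Set.mem_iUnion.2 ⟨_, layer_trans hX hi⟩) hE

/-- Since c > 0 and |R| > 0, the porosity family cannot be empty. Weak porosity thereby guarantees Λ
> 0. -/
theorem holeVol_pos (hD : (9 : ℝ) ≤ 2 ^ (d * p)) (hd : 1 ≤ d) {E : Set ((Fin n → ℝ) × ℝ)}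
    {c δ θ : ℝ} (h : IsWeaklyPorous p d E c δ θ) {R : PRect n} (hR : R.Valid) :
    0 < holeVol p d E R := by
  have hpos : R.Pos := ⟨hR.1, by linarith [hR.2.2]⟩
  obtain ⟨N, P, hP, -, hfree, -, hsum⟩ := h.porous R hR
  rcases N with _ | N
  · have : 0 < ENNReal.ofReal c * R.vol p :=
      ENNReal.mul_pos (ENNReal.ofReal_pos.2 h.c_mem.1).ne' (vol_pos hpos).ne'
    simp only [Finset.univ_eq_empty, Finset.sum_empty] at hsum
    exact absurd this hsum.not_gt
  · obtain ⟨j, hj⟩ := Set.mem_iUnion.1 (hP 0)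
    exact (vol_pos (pos_of_mem_layer hD hpos hj)).trans_le
      (vol_le_holeVol hD hd hpos (hP 0) (hfree 0))

/-! ### Complementary rectangles -/

section Compl

variable {E : Set ((Fin n → ℝ) × ℝ)} {δ θ : ℝ} {R X : PRect n}

theorem exists_layer_succ_of_mem_complRects (hD : (9 : ℝ) ≤ 2 ^ (d * p)) (hd : 1 ≤ d)
    (hR : R.Pos) (hX : X ∈ complRects p d E δ θ R) : ∃ m, X ∈ layer p d R (m + 1) := by
  obtain ⟨hl, hemp, hne⟩ := hX
  obtain ⟨m, hm⟩ := Set.mem_iUnion.1 hl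
  rcases m with _ | m
  · obtain rfl : X = R := hm
    -- The root has no parent, so `parent` returns the root itself, which would have to both miss
    -- and meet the admissible union.
    have hno : ¬ ∃ Q ∈ extLattice p d X, X ∈ children p d Q := by
      rintro ⟨Q, hQ, hc⟩
      obtain ⟨l, hl⟩ := Set.mem_iUnion.1 hQ
      obtain ⟨a, b, rfl, _⟩ := (mem_extLayer hD hR).1 hl
      obtain ⟨a', b', he, _⟩ := (mem_children_cell hD hR).1 hc
      have := (self_eq_cell (p := p) (d := d) X).symm.trans he
      exact absurd (cell_injective hD hd hR this).1 (by omega)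
    rw [parent, dif_neg hno, hemp] at hne
    exact absurd hne Set.not_nonempty_empty
  · exact ⟨m, hm⟩

/-- The parent of a complementary rectangle has a child with a large hole. -/
theorem exists_child_le_holeVol (hD : (9 : ℝ) ≤ 2 ^ (d * p)) (hd : 1 ≤ d)
    (hR : R.Pos) (hX : X ∈ complRects p d E δ θ R) :
    ∃ Q ∈ children p d (parent p d R X),
      ENNReal.ofReal δ * holeVol p d E (R.shift p θ) ≤ holeVol p d E Q := by
  obtain ⟨m, hm⟩ := exists_layer_succ_of_mem_complRects hD hd hR hX
  obtain ⟨-, hemp, z, hzP, hzF⟩ := hX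
  obtain ⟨hpar, hch⟩ := parent_mem_extLayer hD hd hR (layer_subset_extLayer _ _ hm)
  have hparpos := pos_of_mem_extLayer hD hR hpar
  simp only [admUnion, Set.mem_iUnion] at hzF
  obtain ⟨H, hH, hzH⟩ := hzF
  obtain ⟨⟨_, _, hHl, hHE, _⟩, hHv⟩ := id hH
  obtain ⟨j, hj⟩ := Set.mem_iUnion.1 hHl
  have hXpos := pos_of_mem_layer hD hR hm
  -- An admissible hole at the parent's level or coarser would contain the parent, hence X; so the
  -- hole is strictly finer and sits inside a sibling of X.
  rcases le_or_gt j m with hjm | hjm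
  · exfalso
    have h1 := toSet_subset_of_mem_layer hD (pos_of_mem_layer hD hR hj)
      (mem_layer_of_mem_of_mem hD hR hjm (layer_subset_extLayer _ _ hj) hpar hzH hzP)
    obtain ⟨w, hw⟩ := toSet_nonempty (p := p) hXpos
    have hw' := h1 (toSet_subset_of_mem_layer hD hparpos (mem_layer_one.2 hch) hw)
    exact (Set.eq_empty_iff_forall_notMem.1 hemp) w
      ⟨hw, Set.mem_iUnion₂.2 ⟨H, hH, hw'⟩⟩
  · have h1 := mem_layer_of_mem_of_mem hD hR hjm.le hpar (layer_subset_extLayer _ _ hj) hzP hzH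
    obtain ⟨i, hi⟩ := Nat.exists_eq_add_of_lt hjm
    have hi' : j - m = i + 1 := by omega
    rw [hi'] at h1
    obtain ⟨Q, hQ, hHQ⟩ := exists_child_of_mem_layer_succ h1
    exact ⟨Q, hQ, hHv.trans (vol_le_holeVol hD hd
      (pos_of_mem_layer hD hparpos (mem_layer_one.2 hQ)) (Set.mem_iUnion.2 ⟨i, hHQ⟩) hHE)⟩

/-- Complementary rectangles have small holes only. -/
theorem holeVol_lt_of_mem_complRects (hD : (9 : ℝ) ≤ 2 ^ (d * p))
    (hR : R.Pos) (hΛ : 0 < ENNReal.ofReal δ * holeVol p d E (R.shift p θ))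
    (hX : X ∈ complRects p d E δ θ R) :
    holeVol p d E X < ENNReal.ofReal δ * holeVol p d E (R.shift p θ) := by
  by_contra! hle
  obtain ⟨hl, hemp, -⟩ := hX
  obtain ⟨m, hm⟩ := Set.mem_iUnion.1 hl
  have hXpos := pos_of_mem_layer hD hR hm
  -- Positivity of Λ excludes the default value ∅ of the maximal hole.
  obtain ⟨M, hM, hME, hMv⟩ := exists_vol_eq_holeVol (hΛ.trans_le hle)
  obtain ⟨j, hj⟩ := Set.mem_iUnion.1 hM
  obtain ⟨z, hz⟩ := toSet_nonempty (p := p) (pos_of_mem_layer hD hXpos hj)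
  obtain ⟨Y, hY, hzY, hMY⟩ := exists_maxFree hD hR
    (Set.mem_iUnion.2 ⟨_, layer_trans hm hj⟩) hME hz
  refine (Set.eq_empty_iff_forall_notMem.1 hemp) z
    ⟨toSet_subset_of_mem_layer hD hXpos hj hz, Set.mem_iUnion₂.2 ⟨Y, ⟨hY, ?_⟩, hzY⟩⟩
  exact (hle.trans hMv.ge).trans (measure_mono hMY)

end Compl

/-! ### Arithmetic of time steps -/

/-- From `cond₄`: φ ≥ 2, the constant 1 and a ceiling that is at least 1 add up to 4. Hence gaps of
up to θ₀ + 1 are shorter than one parent. -/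
theorem add_four_le_genDiv (hD : (9 : ℝ) ≤ 2 ^ (d * p)) {θ₀ φ Φ : ℤ} (h : ParamsOK p d θ₀ φ Φ)
    (γ : ℝ) (i : ℕ) : θ₀ + 4 ≤ genDiv p d γ i := by
  have h1 : (⌊(2 : ℝ) ^ (d * p)⌋₊ : ℤ) ≤ genDiv p d γ i := by
    exact_mod_cast floor_le_timeDiv _
  rw [Int.natCast_floor_eq_floor (by positivity)] at h1
  have hθ : (2 : ℝ) ≤ θ₀ := by exact_mod_cast h.two_le_θ₀
  have h2 : 0 < ⌈2 * (θ₀ : ℝ) / ((2 : ℝ) ^ (d * p) - 1)⌉ :=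
    Int.ceil_pos.2 (div_pos (by linarith) (by linarith))
  have := h.cond₄
  have := h.two_le_φ
  omega

/-- Makes the lag -1 admissible. -/
theorem sub_le_neg_one (hD : (9 : ℝ) ≤ 2 ^ (d * p)) {θ₀ φ Φ : ℤ} (h : ParamsOK p d θ₀ φ Φ) :
    φ - θ₀ ≤ -1 := by
  have hθ : (2 : ℝ) ≤ θ₀ := by exact_mod_cast h.two_le_θ₀
  have h2 : 0 < ⌈4 * (θ₀ : ℝ) / ((2 : ℝ) ^ (d * p) - 1)⌉ :=
    Int.ceil_pos.2 (div_pos (by linarith) (by linarith))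
  have := h.cond₅
  omega

theorem ediv_sub_bounds {b s K : ℤ} (hK : 0 < K) (hs : 0 ≤ s) (hsK : s ≤ K) :
    b / K - 1 ≤ (b - s) / K ∧ (b - s) / K ≤ b / K := by
  refine ⟨?_, Int.ediv_le_ediv hK (by omega)⟩
  have : (b - K) / K = b / K - 1 := by
    rw [sub_eq_add_neg, ← neg_one_mul K, Int.add_mul_ediv_right _ _ hK.ne']
    ring
  rw [← this]
  exact Int.ediv_le_ediv hK (by omega)

/-! ### Stopping times and hanging cells -/

section StoppingTime

variable {θ₀ φ Φ : ℤ} {E : Set ((Fin n → ℝ) × ℝ)} {R P : PRect n} {Λ : ENNReal}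

theorem exists_of_stopTime_ne_top (h : stopTime p d θ₀ φ Φ E R Λ P ≠ ⊤) :
    ∃ k m : ℕ, stopTime p d θ₀ φ Φ E R Λ P = k ∧ P ∈ extLayer p d R m ∧ 1 ≤ k ∧ k ≤ m ∧
      ∃ θ ∈ Set.Icc ((φ : ℝ) - θ₀) ((Φ : ℝ) - θ₀),
        Λ ≤ holeVol p d E (((fwdParent p d θ₀ R)^[k] P).shift p θ) := by
  refine csInf_mem (s := {κ : ℕ∞ | ∃ k m : ℕ, κ = k ∧ P ∈ extLayer p d R m ∧ 1 ≤ k ∧ k ≤ m ∧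
    ∃ θ ∈ Set.Icc ((φ : ℝ) - θ₀) ((Φ : ℝ) - θ₀),
      Λ ≤ holeVol p d E (((fwdParent p d θ₀ R)^[k] P).shift p θ)}) ?_
  by_contra hne
  rw [Set.not_nonempty_iff_eq_empty] at hne
  exact h (by rw [stopTime, hne, sInf_empty])

theorem stopTime_le {k m : ℕ} (hP : P ∈ extLayer p d R m) (hk : 1 ≤ k) (hkm : k ≤ m) {θ : ℝ}
    (hθ : θ ∈ Set.Icc ((φ : ℝ) - θ₀) ((Φ : ℝ) - θ₀))
    (h : Λ ≤ holeVol p d E (((fwdParent p d θ₀ R)^[k] P).shift p θ)) :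
    stopTime p d θ₀ φ Φ E R Λ P ≤ k :=
  sInf_le ⟨k, m, rfl, hP, hk, hkm, θ, hθ, h⟩

theorem holeVol_lt_of_lt_stopTime (hP : stopTime p d θ₀ φ Φ E R Λ P ≠ ⊤) {j : ℕ} (hj : 1 ≤ j)
    (hlt : (j : ℕ∞) < stopTime p d θ₀ φ Φ E R Λ P) {θ : ℝ}
    (hθ : θ ∈ Set.Icc ((φ : ℝ) - θ₀) ((Φ : ℝ) - θ₀)) :
    holeVol p d E (((fwdParent p d θ₀ R)^[j] P).shift p θ) < Λ := by
  by_contra! hle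
  obtain ⟨k, m, hk, hm, -, hkm, -⟩ := exists_of_stopTime_ne_top hP
  have hjk : j < k := by exact_mod_cast hk ▸ hlt
  exact (stopTime_le hm hj (by omega) hθ hle).not_gt hlt

/-- Iterates of π⁺ from π⁺P are those from P with the index lowered by one, and so is the bound
given by the level. -/
theorem stopTime_fwdParent (hD : (9 : ℝ) ≤ 2 ^ (d * p)) (hd : 1 ≤ d) (hR : R.Pos) {k : ℕ}
    (hk : 1 ≤ k) (hP : stopTime p d θ₀ φ Φ E R Λ P = (k + 1 : ℕ)) :
    stopTime p d θ₀ φ Φ E R Λ (fwdParent p d θ₀ R P) = k := by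
  obtain ⟨k', m, hk', hm, -, hkm, θ, hθ, hle⟩ :=
    exists_of_stopTime_ne_top (hP.trans_ne (ENat.natCast_ne_top _))
  obtain rfl : k + 1 = k' := by exact_mod_cast hP.symm.trans hk'
  obtain ⟨m, rfl⟩ : ∃ m', m = m' + 1 := ⟨m - 1, by omega⟩
  have hm' := fwdParent_mem_extLayer hD hd hR θ₀ hm
  have hub : stopTime p d θ₀ φ Φ E R Λ (fwdParent p d θ₀ R P) ≤ k :=
    stopTime_le hm' hk (by omega) hθ hle
  obtain ⟨l, m₁, hl, hm₁, h1l, hlm, θ', hθ', hle'⟩ :=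
    exists_of_stopTime_ne_top (ne_top_of_le_ne_top (ENat.natCast_ne_top _) hub)
  obtain rfl := extLayer_unique hD hd hR hm' hm₁
  have := stopTime_le (k := l + 1) hm (by omega) (by omega) hθ' hle'
  rw [hP] at this
  rw [hl] at hub ⊢
  have h1 : k + 1 ≤ l + 1 := by exact_mod_cast this
  have h2 : l ≤ k := by exact_mod_cast hub
  rw [le_antisymm h2 (by omega)]

/-- A cell with small holes at all admissible time lags, that has a large hole a few time steps in
the past. -/
def Hanging (p : ℝ) (d : ℕ) (θ₀ φ Φ : ℤ) (E : Set ((Fin n → ℝ) × ℝ)) (R : PRect n) (Λ : ENNReal)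
    (X : PRect n) : Prop :=
  ∃ (l : ℕ) (a : Fin n → ℤ) (b s : ℤ), X = cell p d R l a b ∧ (∀ k, a k / (2 ^ d : ℤ) ^ l = 0) ∧
    0 ≤ s ∧ s ≤ θ₀ + 1 ∧ Λ ≤ holeVol p d E (cell p d R l a (b - s)) ∧
    ∀ θ ∈ Set.Icc ((φ : ℝ) - θ₀) ((Φ : ℝ) - θ₀), holeVol p d E (X.shift p θ) < Λ

/-- The gap starts at θ₀. Each further step divides both time coordinates, leaving a gap of 0 or 1,
and adds θ₀ to the later one; the bound θ₀ + 1 is therefore preserved, while large holes pass to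
ancestors. -/
theorem exists_iterate_fwdParent_eq (hD : (9 : ℝ) ≤ 2 ^ (d * p)) (hd : 1 ≤ d) (hR : R.Pos)
    (h : ParamsOK p d θ₀ φ Φ) {l i : ℕ} (hP : P ∈ extLayer p d R (l + i + 1))
    (hΛ : Λ ≤ holeVol p d E (parent p d R P)) :
    ∃ (a : Fin n → ℤ) (b s : ℤ), (fwdParent p d θ₀ R)^[i + 1] P = cell p d R l a b ∧
      (∀ k, a k / (2 ^ d : ℤ) ^ l = 0) ∧ 0 ≤ s ∧ s ≤ θ₀ + 1 ∧
      Λ ≤ holeVol p d E (cell p d R l a (b - s)) := by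
  have hθ := h.two_le_θ₀
  induction i generalizing l with
  | zero =>
    obtain ⟨a, b, he, ha⟩ := (mem_extLayer hD hR).1 (parent_mem_extLayer hD hd hR hP).1
    refine ⟨a, b + θ₀, θ₀, ?_, ha, by omega, by omega, ?_⟩
    · rw [Function.iterate_one, fwdParent, he, shift_cell]
    · rw [add_sub_cancel_right]
      exact he ▸ hΛ
  | succ i ih =>
    have e : l + (i + 1) + 1 = l + 1 + i + 1 := by omega
    obtain ⟨a, b, s, he, ha, hs, hs', hle⟩ := ih (e ▸ hP)
    have hK := add_four_le_genDiv hD h R.trunc l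
    obtain ⟨h1, h2⟩ := ediv_sub_bounds (b := b) (s := s) (K := genDiv p d R.trunc l)
      (by omega) hs (by omega)
    refine ⟨fun k => a k / 2 ^ d, b / genDiv p d R.trunc l + θ₀,
      b / genDiv p d R.trunc l + θ₀ - (b - s) / genDiv p d R.trunc l, ?_, fun k => ?_,
      by omega, by omega, ?_⟩
    · rw [Function.iterate_succ_apply', he, fwdParent,
        parent_cell hD hd hR ((mem_extLayer hD hR).2 ⟨_, _, rfl, ha⟩), shift_cell]
    · rw [Int.ediv_ediv_of_nonneg (by positivity), ← pow_succ', ha]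
    · rw [sub_sub_cancel]
      refine hle.trans (holeVol_mono hD hd (cell_pos hD hR _ _ _) (mem_layer_one.2 ?_))
      exact (mem_children_cell hD hR).2 ⟨_, _, rfl, fun k => rfl, rfl⟩

/-- If the finer cell met the coarser one, the ancestor of its past hole would be the coarser cell
or its predecessor in time, where holes are small. -/
theorem not_mem_inter_of_hole (hD : (9 : ℝ) ≤ 2 ^ (d * p)) (hd : 1 ≤ d) (hR : R.Pos)
    (h : ParamsOK p d θ₀ φ Φ) {l j : ℕ} (hj : 1 ≤ j) {a a' : Fin n → ℤ} {b b' s : ℤ}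
    (hs : 0 ≤ s) (hs' : s ≤ θ₀ + 1) (hle : Λ ≤ holeVol p d E (cell p d R (l + j) a' (b' - s)))
    (hlt : ∀ θ ∈ Set.Icc ((φ : ℝ) - θ₀) ((Φ : ℝ) - θ₀),
      holeVol p d E ((cell p d R l a b).shift p θ) < Λ) {z : (Fin n → ℝ) × ℝ}
    (hz : z ∈ (cell p d R (l + j) a' b').toSet p) : z ∉ (cell p d R l a b).toSet p := by
  intro hz'
  obtain ⟨ha, hb⟩ := (mem_toSet_cell_iff_of_mem hD hR hz).1 hz'
  have hK : θ₀ + 4 ≤ divProd p d R.trunc l j := by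
    obtain ⟨m, rfl⟩ : ∃ m, j = m + 1 := ⟨j - 1, by omega⟩
    have h1 : genDiv p d R.trunc (l + m) ≤ divProd p d R.trunc l (m + 1) :=
      Nat.le_mul_of_pos_left _ (divProd_pos hD _ _ _)
    have h2 := add_four_le_genDiv hD h R.trunc (l + m)
    omega
  obtain ⟨h1, h2⟩ := ediv_sub_bounds (b := b') (s := s) (K := divProd p d R.trunc l j)
    (by have := h.two_le_θ₀; omega) hs (by omega)
  rw [hb] at h1 h2
  have hφ := sub_le_neg_one hD h
  obtain ⟨-, hΦ⟩ := h.cond₂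
  -- The lag is a difference of quotients, equal to 0 or -1.
  have hr := hlt (((b' - s) / divProd p d R.trunc l j - b : ℤ) : ℝ)
    ⟨by exact_mod_cast (by omega : φ - θ₀ ≤ (b' - s) / divProd p d R.trunc l j - b),
      by exact_mod_cast (by omega : (b' - s) / divProd p d R.trunc l j - b ≤ Φ - θ₀)⟩
  rw [shift_cell, add_sub_cancel] at hr
  exact (hle.trans (holeVol_mono hD hd (cell_pos hD hR _ _ _)
    ((mem_layer_cell hD hR).2 ⟨_, _, rfl, ha, rfl⟩))).not_gt hr

theorem Hanging.disjoint (hD : (9 : ℝ) ≤ 2 ^ (d * p)) (hd : 1 ≤ d) (hR : R.Pos)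
    (h : ParamsOK p d θ₀ φ Φ) {U V : PRect n} (hU : Hanging p d θ₀ φ Φ E R Λ U)
    (hV : Hanging p d θ₀ φ Φ E R Λ V) (hne : U ≠ V) :
    Disjoint (U.toSet p) (V.toSet p) := by
  obtain ⟨i, a, b, s, rfl, -, hs, hs', hle, hlt⟩ := hU
  obtain ⟨j, a', b', t, rfl, -, ht, ht', hle', hlt'⟩ := hV
  rw [Set.disjoint_left]
  intro z hz hz'
  rcases lt_trichotomy i j with hij | rfl | hij
  · obtain ⟨m, rfl⟩ := Nat.exists_eq_add_of_le hij.le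
    exact not_mem_inter_of_hole hD hd hR h (by omega) ht ht' hle' hlt hz' hz
  · rw [mem_toSet_cell hD hR] at hz hz'
    have h1 : a = a' := funext fun k => (hz.1 k).symm.trans (hz'.1 k)
    have h2 : b = b' := hz.2.symm.trans hz'.2
    exact hne (by rw [h1, h2])
  · obtain ⟨m, rfl⟩ := Nat.exists_eq_add_of_le hij.le
    exact not_mem_inter_of_hole hD hd hR h (by omega) hs hs' hle hlt' hz hz'

end StoppingTime

/-! ### The stopping collections -/

section StoppingCollection

variable {θ₀ φ Φ : ℤ} {E : Set ((Fin n → ℝ) × ℝ)} {R P X : PRect n} {δ : ℝ} {k : ℕ}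

theorem hanging_iterate (hD : (9 : ℝ) ≤ 2 ^ (d * p)) (hd : 1 ≤ d) (hR : R.Pos)
    (h : ParamsOK p d θ₀ φ Φ) (hP : P ∈ complRects p d E δ Φ R) {i : ℕ} (hi : 1 ≤ i)
    (hτ : stopTime p d θ₀ φ Φ E R (ENNReal.ofReal δ * holeVol p d E (R.shift p Φ)) P ≠ ⊤)
    (hlt : (i : ℕ∞) <
      stopTime p d θ₀ φ Φ E R (ENNReal.ofReal δ * holeVol p d E (R.shift p Φ)) P) :
    Hanging p d θ₀ φ Φ E R (ENNReal.ofReal δ * holeVol p d E (R.shift p Φ))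
      ((fwdParent p d θ₀ R)^[i] P) := by
  obtain ⟨k, m, hk, hm, -, hkm, -⟩ := exists_of_stopTime_ne_top hτ
  have hik : i < k := by exact_mod_cast hk ▸ hlt
  obtain ⟨i, rfl⟩ : ∃ i', i = i' + 1 := ⟨i - 1, by omega⟩
  obtain ⟨l, rfl⟩ : ∃ l, m = l + i + 1 := ⟨m - i - 1, by omega⟩
  obtain ⟨Q, hQ, hle⟩ := exists_child_le_holeVol hD hd hR hP
  have hpar := pos_of_mem_extLayer hD hR (parent_mem_extLayer hD hd hR hm).1
  obtain ⟨a, b, s, he, ha, hs, hs', hle'⟩ := exists_iterate_fwdParent_eq hD hd hR h hm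
    (hle.trans (holeVol_mono hD hd hpar (mem_layer_one.2 hQ)))
  exact ⟨l, a, b, s, he, ha, hs, hs', hle', fun θ hθ => holeVol_lt_of_lt_stopTime hτ hi hlt hθ⟩

theorem mem_complRects_or_hanging (hD : (9 : ℝ) ≤ 2 ^ (d * p)) (hd : 1 ≤ d) (hR : R.Pos)
    (h : ParamsOK p d θ₀ φ Φ) (hX : X ∈ stopS p d θ₀ φ Φ E δ R k) :
    X ∈ complRects p d E δ Φ R ∨
      Hanging p d θ₀ φ Φ E R (ENNReal.ofReal δ * holeVol p d E (R.shift p Φ)) X := by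
  obtain ⟨P, hP, i, hτ, hi, rfl, -⟩ := hX
  rcases Nat.eq_zero_or_pos i with rfl | hi0
  · exact Or.inl hP
  · exact Or.inr (hanging_iterate hD hd hR h hP hi0 hτ hi)

theorem exists_extLayer_of_mem_stopS (hX : X ∈ stopS p d θ₀ φ Φ E δ R k) :
    ∃ m, X ∈ extLayer p d R (m + 1) := by
  obtain ⟨-, -, -, -, -, -, hX⟩ := hX
  obtain ⟨j, m, -, hm, h1, hjm, -⟩ :=
    exists_of_stopTime_ne_top (hX.trans_ne (ENat.natCast_ne_top _))
  exact ⟨m - 1, by rwa [Nat.sub_add_cancel (by omega)]⟩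

theorem holeVol_lt_of_mem_stopS (hD : (9 : ℝ) ≤ 2 ^ (d * p)) (hd : 1 ≤ d) (hR : R.Pos)
    (h : ParamsOK p d θ₀ φ Φ)
    (hΛ : 0 < ENNReal.ofReal δ * holeVol p d E (R.shift p Φ))
    (hX : X ∈ stopS p d θ₀ φ Φ E δ R k) :
    holeVol p d E X < ENNReal.ofReal δ * holeVol p d E (R.shift p Φ) := by
  rcases mem_complRects_or_hanging hD hd hR h hX with hX | ⟨_, _, _, _, _, _, _, _, _, hlt⟩
  · exact holeVol_lt_of_mem_complRects hD hR hΛ hX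
  · have h0 : X.shift p 0 = X := by ext1 <;> simp [shift]
    have := hlt 0 ⟨by exact_mod_cast (by linarith [h.cond₂.1] : φ - θ₀ ≤ 0),
      by exact_mod_cast (by linarith [h.cond₂.2] : 0 ≤ Φ - θ₀)⟩
    rwa [h0] at this

theorem fwdParent_mem_stopS (hD : (9 : ℝ) ≤ 2 ^ (d * p)) (hd : 1 ≤ d) (hR : R.Pos)
    (h : ParamsOK p d θ₀ φ Φ) (hk : 1 ≤ k) (hX : X ∈ stopS p d θ₀ φ Φ E δ R (k + 1)) :
    fwdParent p d θ₀ R X ∈ stopS p d θ₀ φ Φ E δ R k ∧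
      Hanging p d θ₀ φ Φ E R (ENNReal.ofReal δ * holeVol p d E (R.shift p Φ))
        (fwdParent p d θ₀ R X) := by
  obtain ⟨m, hm⟩ := exists_extLayer_of_mem_stopS hX
  obtain ⟨P, hP, i, hτ, hi, rfl, hXτ⟩ := hX
  have hlt : ((i + 1 : ℕ) : ℕ∞) <
      stopTime p d θ₀ φ Φ E R (ENNReal.ofReal δ * holeVol p d E (R.shift p Φ)) P := by
    obtain ⟨j, _, hj, _, -, -, θ, hθ, hle⟩ := exists_of_stopTime_ne_top hτ
    rw [hj] at hi ⊢
    have hij : i < j := by exact_mod_cast hi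
    -- If π⁺X were the stopping iterate of P, X would have stopping time 1 rather than k + 1 ≥ 2.
    have hne : i + 1 ≠ j := by
      rintro rfl
      rw [Function.iterate_succ_apply'] at hle
      have := stopTime_le (k := 1) hm le_rfl (by omega) hθ hle
      rw [hXτ] at this
      have : k + 1 ≤ 1 := by exact_mod_cast this
      omega
    exact_mod_cast (by omega : i + 1 < j)
  have hst := stopTime_fwdParent hD hd hR hk hXτ
  rw [← Function.iterate_succ_apply' (fwdParent p d θ₀ R)] at hst ⊢
  exact ⟨⟨P, hP, i + 1, hτ, hlt, rfl, hst⟩, hanging_iterate hD hd hR h hP (by omega) hτ hlt⟩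

/-- Not all children of a rectangle belong to the same stopping collection. -/
theorem not_children_subset_stopS (hD : (9 : ℝ) ≤ 2 ^ (d * p)) (hd : 1 ≤ d) (hR : R.Pos)
    (h : ParamsOK p d θ₀ φ Φ)
    (hΛ : 0 < ENNReal.ofReal δ * holeVol p d E (R.shift p Φ))
    (hP : P ∈ stopS p d θ₀ φ Φ E δ R k) :
    ¬ (parent p d R P).children p d ⊆ stopS p d θ₀ φ Φ E δ R k := by
  intro hsub
  obtain ⟨l, hl⟩ := exists_extLayer_of_mem_stopS hP
  obtain ⟨a, b, rfl, ha⟩ := (mem_extLayer hD hR).1 hl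
  rw [parent_cell hD hd hR hl] at hsub
  have hK := add_four_le_genDiv hD h R.trunc l
  have hθ := h.two_le_θ₀
  set K : ℤ := (genDiv p d R.trunc l : ℤ) with hKdef
  have hmem : ∀ r : ℤ, 0 ≤ r → r < K → cell p d R (l + 1) a (r + b / K * K) ∈
      children p d (cell p d R l (fun k => a k / 2 ^ d) (b / K)) := by
    intro r h0 h1
    refine (mem_children_cell hD hR).2 ⟨_, _, rfl, fun k => rfl, ?_⟩
    rw [← hKdef, Int.add_mul_ediv_right _ _ (by omega), Int.ediv_eq_zero_of_lt h0 h1, zero_add]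
  -- A child in the last time row: everything up to K - 1 steps earlier is still a sibling.
  have htop := hmem (K - 1) (by omega) (by omega)
  rcases mem_complRects_or_hanging hD hd hR h (hsub htop) with
    hX | ⟨l', a', c, s, he, -, hs, hs', hle, -⟩
  · obtain ⟨Q, hQ, hle⟩ := exists_child_le_holeVol hD hd hR hX
    rw [parent_cell hD hd hR ((mem_extLayer hD hR).2 ⟨_, _, rfl, ha⟩), ← hKdef,
      Int.add_mul_ediv_right _ _ (by omega), Int.ediv_eq_zero_of_lt (by omega) (by omega),
      zero_add] at hQ
    exact hle.not_gt (holeVol_lt_of_mem_stopS hD hd hR h hΛ (hsub hQ))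
  · obtain ⟨rfl, rfl, rfl⟩ := cell_injective hD hd hR he
    have hT := hmem (K - 1 - s) (by omega) (by omega)
    have e : K - 1 + b / K * K - s = K - 1 - s + b / K * K := by ring
    rw [e] at hle
    exact hle.not_gt (holeVol_lt_of_mem_stopS hD hd hR h hΛ (hsub hT))

/-- Ensures that rectangles with equal forward parents are siblings. -/
theorem shift_injective (θ : ℝ) : Function.Injective (shift p θ : PRect n → PRect n) := by
  intro P Q hPQ
  have h1 : P.corner = Q.corner := congrArg (fun X => X.corner) hPQ
  have h2 : P.side = Q.side := congrArg (fun X => X.side) hPQ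
  have h3 : P.trunc = Q.trunc := congrArg (fun X => X.trunc) hPQ
  have h4 : P.bottom + θ * P.lt p = Q.bottom + θ * Q.lt p := congrArg PRect.bottom hPQ
  have h5 : P.lt p = Q.lt p := by rw [PRect.lt, PRect.lt, h2, h3]
  exact PRect.ext h1 (by rw [h5] at h4; linarith) h2 h3

/-- A proper subfamily of the children of a rectangle misses a fixed proportion of it. -/
theorem volume_biUnion_le_of_ssubset_children (hD : (9 : ℝ) ≤ 2 ^ (d * p)) {Q : PRect n}
    (hQ : Q.Pos) {C : Set (PRect n)} (hC : C ⊂ children p d Q) :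
    volume (⋃ X ∈ C, X.toSet p) ≤
      ENNReal.ofReal (1 - 1 / ((2 ^ d) ^ n * ⌈(2 : ℝ) ^ (d * p)⌉₊ : ℕ)) * Q.vol p := by
  set K := timeDiv p d Q.trunc with hKdef
  have hK : 0 < K := timeDiv_pos hD _
  have hKr : (0 : ℝ) < K := by exact_mod_cast hK
  set N := (2 ^ d) ^ n * K with hN
  -- A bound on the number of children that does not depend on the truncation parameter.
  set N' := (2 ^ d) ^ n * ⌈(2 : ℝ) ^ (d * p)⌉₊ with hN'
  have hNpos : 0 < N := by positivity
  have hNN' : N ≤ N' := Nat.mul_le_mul_left _ (timeDiv_le_ceil _)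
  have hrange : children p d Q = Set.range fun x : (Fin n → Fin (2 ^ d)) × Fin K =>
      child p d Q x.1 x.2 := by
    ext X
    constructor
    · rintro ⟨a, b, rfl⟩
      exact ⟨(a, b), rfl⟩
    · rintro ⟨⟨a, b⟩, rfl⟩
      exact ⟨a, b, rfl⟩
  have hfin : (children p d Q).Finite := hrange ▸ Set.finite_range _
  have hcard : (children p d Q).ncard ≤ N := by
    rw [hrange, ← Set.image_univ]
    refine (Set.ncard_image_le Set.finite_univ).trans ?_
    simp [Set.ncard_univ, Nat.card_eq_fintype_card, hN]
  have hCcard : C.ncard < N := (Set.ncard_lt_ncard hC hfin).trans_le hcard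
  have hCfin : C.Finite := hfin.subset hC.subset
  set v := ENNReal.ofReal ((Q.side / 2 ^ d) ^ n * (Q.lt p / K)) with hv
  have hvol : ∀ X ∈ C, X.vol p = v := by
    intro X hX
    obtain ⟨a, b, rfl, -⟩ := (mem_layer hD hQ).1 (mem_layer_one.2 (hC.subset hX))
    have h1 : genDur p d Q 0 = Q.lt p := by simp [genDur, genTrunc, PRect.lt]
    rw [vol_eq, cell_lt, ← zero_add 1, genDur_succ hQ, h1, hv,
      ENNReal.ofReal_mul (by have := hQ.1; positivity),
      ENNReal.ofReal_pow (by have := hQ.1; positivity)]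
    simp [cell, genDiv, genTrunc, hKdef]
  have hQvol : Q.vol p = N * v := by
    rw [vol_eq, hv, ← ENNReal.ofReal_natCast, ← ENNReal.ofReal_mul (by positivity),
      ← ENNReal.ofReal_pow hQ.1.le, ← ENNReal.ofReal_mul (by have := hQ.1; positivity), hN]
    congr 1
    push_cast
    rw [div_pow]
    field_simp
  calc volume (⋃ X ∈ C, X.toSet p)
      ≤ ∑ X ∈ hCfin.toFinset, X.vol p := by
        have : (⋃ X ∈ C, X.toSet p) = ⋃ X ∈ hCfin.toFinset, X.toSet p := by simp
        rw [this]
        exact measure_biUnion_finset_le _ _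
    _ = C.ncard * v := by
        rw [Finset.sum_congr rfl fun X hX => hvol X (hCfin.mem_toFinset.1 hX), Finset.sum_const,
          nsmul_eq_mul, Set.ncard_eq_toFinset_card C hCfin]
    _ ≤ ENNReal.ofReal (1 - 1 / N') * N * v := by
        gcongr
        have h1 : (C.ncard : ℝ) + 1 ≤ N := by exact_mod_cast hCcard
        have h2 : (N : ℝ) ≤ N' := by exact_mod_cast hNN'
        have h3 : (0 : ℝ) < N := by exact_mod_cast hNpos
        have h4 : (N : ℝ) / N' ≤ 1 := (div_le_one (by linarith)).2 h2
        rw [← ENNReal.ofReal_natCast C.ncard, ← ENNReal.ofReal_natCast N,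
          ← ENNReal.ofReal_mul' (by positivity)]
        refine ENNReal.ofReal_le_ofReal ?_
        have : (1 - 1 / (N' : ℝ)) * N = N - N / N' := by ring
        linarith
    _ = _ := by rw [hQvol, mul_assoc]

theorem countable_stopS (hD : (9 : ℝ) ≤ 2 ^ (d * p)) (hR : R.Pos) :
    (stopS p d θ₀ φ Φ E δ R k).Countable := by
  refine (Set.countable_range fun x : ℕ × (Fin n → ℤ) × ℤ =>
    cell p d R x.1 x.2.1 x.2.2).mono fun X hX => ?_
  obtain ⟨m, hm⟩ := exists_extLayer_of_mem_stopS hX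
  obtain ⟨a, b, rfl, -⟩ := (mem_extLayer hD hR).1 hm
  exact ⟨(m + 1, a, b), rfl⟩

theorem pairwiseDisjoint_fwdParent_stopS (hD : (9 : ℝ) ≤ 2 ^ (d * p)) (hd : 1 ≤ d) (hR : R.Pos)
    (h : ParamsOK p d θ₀ φ Φ) (hk : 1 ≤ k) :
    (fwdParent p d θ₀ R '' stopS p d θ₀ φ Φ E δ R (k + 1)).PairwiseDisjoint (toSet p) := by
  rintro _ ⟨P, hP, rfl⟩ _ ⟨Q, hQ, rfl⟩ hne
  exact (fwdParent_mem_stopS hD hd hR h hk hP).2.disjoint hD hd hR h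
    (fwdParent_mem_stopS hD hd hR h hk hQ).2 hne

/-- Group 𝒮_{k+1} by forward parent U: each group covers at most the fraction λ of |U|, and the U
are disjoint members of 𝒮_k. -/
theorem volume_stopS_succ_le (hD : (9 : ℝ) ≤ 2 ^ (d * p)) (hd : 1 ≤ d) (hR : R.Pos)
    (h : ParamsOK p d θ₀ φ Φ)
    (hΛ : 0 < ENNReal.ofReal δ * holeVol p d E (R.shift p Φ)) (hk : 1 ≤ k) :
    volume (⋃ Q ∈ stopS p d θ₀ φ Φ E δ R (k + 1), Q.toSet p) ≤
      ENNReal.ofReal (1 - 1 / ((2 ^ d) ^ n * ⌈(2 : ℝ) ^ (d * p)⌉₊ : ℕ)) *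
        volume (⋃ Q ∈ stopS p d θ₀ φ Φ E δ R k, Q.toSet p) := by
  set S := stopS p d θ₀ φ Φ E δ R (k + 1) with hS
  set f := fwdParent p d θ₀ R with hf
  have hcount : (f '' S).Countable := (countable_stopS hD hR).image _
  have hfiber : ∀ U ∈ f '' S, volume (⋃ P ∈ {P ∈ S | f P = U}, P.toSet p) ≤
      ENNReal.ofReal (1 - 1 / ((2 ^ d) ^ n * ⌈(2 : ℝ) ^ (d * p)⌉₊ : ℕ)) * U.vol p := by
    rintro _ ⟨P, hP, rfl⟩
    obtain ⟨m, hm⟩ := exists_extLayer_of_mem_stopS hP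
    rw [hf, fwdParent, vol_shift]
    refine volume_biUnion_le_of_ssubset_children hD
      (pos_of_mem_extLayer hD hR (parent_mem_extLayer hD hd hR hm).1) ⟨?_, fun hsub => ?_⟩
    · rintro P' ⟨hP', he⟩
      obtain ⟨m', hm'⟩ := exists_extLayer_of_mem_stopS hP'
      rw [← shift_injective _ he]
      exact (parent_mem_extLayer hD hd hR hm').2
    · exact not_children_subset_stopS hD hd hR h hΛ hP (hsub.trans fun _ hX => hX.1)
  calc volume (⋃ Q ∈ S, Q.toSet p)
      ≤ volume (⋃ U ∈ f '' S, ⋃ P ∈ {P ∈ S | f P = U}, P.toSet p) := by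
        refine measure_mono (Set.iUnion₂_subset fun P hP z hz => ?_)
        exact Set.mem_iUnion₂.2 ⟨f P, ⟨P, hP, rfl⟩, Set.mem_iUnion₂.2 ⟨P, ⟨hP, rfl⟩, hz⟩⟩
    _ ≤ ∑' U : f '' S, volume (⋃ P ∈ {P ∈ S | f P = U}, P.toSet p) :=
        measure_biUnion_le _ hcount _
    _ ≤ ∑' U : f '' S, ENNReal.ofReal (1 - 1 / ((2 ^ d) ^ n * ⌈(2 : ℝ) ^ (d * p)⌉₊ : ℕ)) *
          volume (U.1.toSet p) := ENNReal.tsum_le_tsum fun U => hfiber U.1 U.2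
    _ = ENNReal.ofReal (1 - 1 / ((2 ^ d) ^ n * ⌈(2 : ℝ) ^ (d * p)⌉₊ : ℕ)) *
          volume (⋃ U ∈ f '' S, U.toSet p) := by
        rw [ENNReal.tsum_mul_left, measure_biUnion hcount
          (pairwiseDisjoint_fwdParent_stopS hD hd hR h hk) fun U _ => measurableSet_toSet U]
    _ ≤ _ := by
        refine mul_le_mul_right (measure_mono (Set.biUnion_subset_biUnion_left ?_)) _
        rintro _ ⟨P, hP, rfl⟩
        exact (fwdParent_mem_stopS hD hd hR h hk hP).1

end StoppingCollection
end PRect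

end

/-! ### Assembly -/

theorem mainTheorem9 (n : ℕ) (p : ℝ) (hp : 1 < p) (d : ℕ) (hd : 1 ≤ d)
    (hdp : Real.logb 2 9 ≤ d * p) :
    ∃ lam : ℝ, 0 < lam ∧ lam < 1 ∧
      ∀ (θ₀ φ Φ : ℤ), ParamsOK p d θ₀ φ Φ →
      ∀ (E : Set ((Fin n → ℝ) × ℝ)) (c δ : ℝ), IsWeaklyPorous p d E c δ Φ →
      ∀ R : PRect n, R.Valid →
      ∀ k : ℕ, 1 ≤ k →
        (∀ C ⊆ PRect.stopS p d θ₀ φ Φ E δ R k, C.Nonempty →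
          (∀ P ∈ C, C ⊆ (PRect.parent p d R P).children p d) →
          ∀ P ∈ C, C ⊂ (PRect.parent p d R P).children p d) ∧
        (PRect.fwdParent p d θ₀ R '' PRect.stopS p d θ₀ φ Φ E δ R (k + 1)).PairwiseDisjoint
          (PRect.toSet p) ∧
        volume (⋃ Q ∈ PRect.stopS p d θ₀ φ Φ E δ R (k + 1), Q.toSet p) ≤
          ENNReal.ofReal lam ^ k *
            volume (⋃ P ∈ PRect.stopS p d θ₀ φ Φ E δ R 1, P.toSet p) := by
  have hD : (9 : ℝ) ≤ 2 ^ (d * p) := (Real.logb_le_iff_le_rpow (by norm_num) (by norm_num)).1 hdp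
  have hN : 2 ≤ (2 ^ d) ^ n * ⌈(2 : ℝ) ^ (d * p)⌉₊ := by
    have h1 : 2 ≤ ⌈(2 : ℝ) ^ (d * p)⌉₊ := by
      have : ((9 : ℕ) : ℝ) ≤ ⌈(2 : ℝ) ^ (d * p)⌉₊ := by
        push_cast
        exact hD.trans (Nat.le_ceil _)
      have : 9 ≤ ⌈(2 : ℝ) ^ (d * p)⌉₊ := by exact_mod_cast this
      omega
    exact h1.trans (Nat.le_mul_of_pos_left _ (by positivity))
  have hNr : (2 : ℝ) ≤ ((2 ^ d) ^ n * ⌈(2 : ℝ) ^ (d * p)⌉₊ : ℕ) := by exact_mod_cast hN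
  have hNpos : (0 : ℝ) < 1 / ((2 ^ d) ^ n * ⌈(2 : ℝ) ^ (d * p)⌉₊ : ℕ) := by positivity
  have hN1 : 1 / (((2 ^ d) ^ n * ⌈(2 : ℝ) ^ (d * p)⌉₊ : ℕ) : ℝ) < 1 := by
    rw [div_lt_one (by linarith)]
    linarith
  refine ⟨1 - 1 / ((2 ^ d) ^ n * ⌈(2 : ℝ) ^ (d * p)⌉₊ : ℕ), by linarith, by linarith, ?_⟩
  intro θ₀ φ Φ h E c δ hE R hRv k hk
  have hR : R.Pos := ⟨hRv.1, by linarith [hRv.2.2]⟩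
  have hΛ : 0 < ENNReal.ofReal δ * PRect.holeVol p d E (R.shift p Φ) :=
    ENNReal.mul_pos (ENNReal.ofReal_pos.2 hE.δ_mem.1).ne'
      (PRect.holeVol_pos hD hd hE (show (R.shift p Φ).Valid from hRv)).ne'
  refine ⟨fun C hC _ hch P hP => ⟨hch P hP, fun hsub => ?_⟩,
    PRect.pairwiseDisjoint_fwdParent_stopS hD hd hR h hk, ?_⟩
  · exact PRect.not_children_subset_stopS hD hd hR h hΛ (hC hP) (hsub.trans hC)
  -- The estimate also holds trivially for k = 0, where the induction starts.
  · clear hk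
    induction k with
    | zero => simp
    | succ k ih =>
      rw [pow_succ', mul_assoc]
      exact (PRect.volume_stopS_succ_le hD hd hR h hΛ (by omega)).trans (mul_le_mul_right ih _)
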